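/- Let $\alpha\in\mathbb R$, $\lambda,c,d>0$ and $\pi\in[0,1]$. On a probability space $(\Omega,\mathcal F,\mathbb P_\pi)$ let $W$ be a standard Brownian motion with continuous paths and let $\Theta\ge 0$ be an independent random variable with $\mathbb P_\pi(\Theta=0)=\pi$ and $\mathbb P_\pi(\Theta>t)=(1-\pi)e^{-\lambda t}$ for $t\ge 0$. Put $X_t=\alpha(t-\Theta)^++W_t$. Let $\mathcal T$ be the set of sequences $\hat\tau=(\tau_1,\tau_2,\dots)$ of $(0,\infty]$-valued random times, strictly increasing as long as they are finite and equal to $\infty$ afterwards, such that $\tau_1>0$ is deterministic and, for $j\ge 2$, $\tau_j$ is measurable with respect to $\sigma(X_{\tau_1},\dots,X_{\tau_{j-1}},\tau_1,\dots,\tau_{j-1})$ (an observation at time $\infty$ is never made and carries no information). Put $\tau_0:=0$. For $\hat\tau\in\mathcal T$ let $\mathcal F^{\hat\tau}_t$ be the $\sigma$-algebra generated by the observations made up to time $t$, i.e. $\mathcal F^{\hat\tau}_t=\sigma(X_{\tau_1},\dots,X_{\tau_j},\tau_1,\dots,\tau_j)$ with the random index $j=\sup\{k:\tau_k\le t\}$.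 Let $\mathcal S^{\hat\tau}$ be the set of $[0,\infty]$-valued stopping times of $(\mathcal F^{\hat\tau}_t)_{t\ge0}$, and let $\mathcal S^{\hat\tau}_0$ be the set of those $\tau\in\mathcal S^{\hat\tau}$ for which, $\mathbb P_\pi$-a.s., $\tau=\tau_k$ for some $k=k(\omega)\ge 0$. Define $$V(\pi)=\inf_{\hat\tau\in\mathcal T}\ \inf_{\tau\in\mathcal S^{\hat\tau}}\Big\{\mathbb P_\pi(\tau<\Theta)+\mathbb E_\pi\Big[c(\tau-\Theta)^++d\sum_{k=1}^\infty \mathbf 1_{\{\tau_k\le\tau\}}\Big]\Big\}$$ and $$F(q)=\inf_{t\ge0}\Big\{(1-q)e^{-\lambda t}+c\int_0^t\big(1-(1-q)e^{-\lambda s}\big)\,ds\Big\},\qquad q\in[0,1].$$ Then for every $\hat\tau\in\mathcal T$ the a posteriori probability process $\Pi^{\hat\tau}_t=\mathbb P_\pi(\Theta\le t\mid\mathcal F^{\hat\tau}_t)$ has an adapted version with right-continuous paths, and, whichever such versions are used, $$V(\pi)=\inf_{\hat\tau\in\mathcal T}\ \inf_{\tau\in\mathcal S^{\hat\tau}_0}\mathbb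 E_\pi\Big[F(\Pi^{\hat\tau}_\tau)+c\tau-\frac c\lambda\sum_{k=0}^\infty(1-\Pi^{\hat\tau}_{\tau_k})\big(1-e^{-\lambda(\tau_{k+1}-\tau_k)}\big)\mathbf 1_{\{\tau_{k+1}\le\tau\}}+d\sum_{k=1}^\infty\mathbf 1_{\{\tau_k\le\tau\}}\Big].$$ (The expectation is $+\infty$ if $\mathbb P_\pi(\tau=\infty)>0$.) -/

import Mathlib

open MeasureTheory ProbabilityTheory Set
open scoped NNReal ENNReal Topology

noncomputable section

namespace CostlyDisorder

/-- The probabilistic data of the Wiener disorder problem on a probability space `(Ω, P)`: a standard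
Brownian motion `W` with continuous paths, and an independent disorder time `Θ ≥ 0` with
`P(Θ = 0) = p` and `P(Θ > t) = (1 - p) e^{-lam t}` for `t ≥ 0`. -/
structure DisorderModel {Ω : Type*} [MeasurableSpace Ω] (P : Measure Ω) (p lam : ℝ) where
  /-- the Brownian motion -/
  W : ℝ≥0 → Ω → ℝ
  /-- the disorder time -/
  Θ : Ω → ℝ≥0
  measurable_W : ∀ t, Measurable (W t)
  continuous_W : ∀ ω, Continuous fun t => W t ω
  brownian_W : IsBrownianReal W P
  measurable_Θ : Measurable Θ
  law_zero : P {ω | Θ ω = 0} = ENNReal.ofReal p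
  law_tail : ∀ t : ℝ≥0, P {ω | t < Θ ω} = ENNReal.ofReal ((1 - p) * Real.exp (-lam * t))
  indep : IndepFun Θ (fun ω t => W t ω) P

/-- The value `X_T` observed at a random time `T`; nothing is observed (value `0`) if `T = ∞`. -/
def observed {Ω : Type*} (X : ℝ≥0 → Ω → ℝ) (T : Ω → ℝ≥0∞) (ω : Ω) : ℝ :=
  if T ω = ∞ then 0 else X (T ω).toNNReal ω

/-- What is known at time `t` about the `i`-th observation: the pair `(τ_i, X_{τ_i})` if `τ_i ≤ t`,
and the placeholder `(∞, 0)` if the observation has not been made yet. -/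
def record {Ω : Type*} (X : ℝ≥0 → Ω → ℝ) (τ : ℕ → Ω → ℝ≥0∞) (i : ℕ) (t : ℝ≥0) (ω : Ω) : ℝ≥0∞ × ℝ :=
  if τ i ω ≤ t then (τ i ω, observed X (τ i) ω) else (∞, 0)

lemma record_of_le {Ω : Type*} (X : ℝ≥0 → Ω → ℝ) (τ : ℕ → Ω → ℝ≥0∞) (i : ℕ) {r t : ℝ≥0} (h : r ≤ t) :
    record X τ i r = (fun a : ℝ≥0∞ × ℝ => if a.1 ≤ r then a else (∞, 0)) ∘ record X τ i t := by
  funext ω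
  have h' : (r : ℝ≥0∞) ≤ t := by exact_mod_cast h
  by_cases h1 : τ i ω ≤ r
  · simp [record, h1, h1.trans h']
  · by_cases h2 : τ i ω ≤ t <;> simp [record, h1, h2]

section

variable {Ω : Type*} [MeasurableSpace Ω] {P : Measure Ω} {p lam : ℝ}

/-- The observation process `X_t = α (t - Θ)⁺ + W_t`. -/
def DisorderModel.X (M : DisorderModel P p lam) (α : ℝ) (t : ℝ≥0) (ω : Ω) : ℝ :=
  α * max ((t : ℝ) - M.Θ ω) 0 + M.W t ω

/-- The σ-algebra `σ(X_{τ_1}, …, X_{τ_j}, τ_1, …, τ_j)`; it is trivial for `j = 0`. -/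
@[reducible] def history (X : ℝ≥0 → Ω → ℝ) (τ : ℕ → Ω → ℝ≥0∞) (j : ℕ) : MeasurableSpace Ω :=
  ⨆ i ∈ Finset.Icc 1 j,
    MeasurableSpace.comap (fun ω => (τ i ω, observed X (τ i) ω)) inferInstance

/-- An observation strategy: the sequence `τ_1 < τ_2 < ⋯` of observation times, together with the
convention `τ_0 = 0`. Times may be infinite (the corresponding observations are never made), and the
sequence is strictly increasing as long as it is finite. -/
structure ObsSeq (X : ℝ≥0 → Ω → ℝ) where
  /-- the observation times -/
  time : ℕ → Ω → ℝ≥0∞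
  time_zero : ∀ ω, time 0 ω = 0
  lt_succ : ∀ k ω, time k ω ≠ ∞ → time k ω < time (k + 1) ω
  top_succ : ∀ k ω, time k ω = ∞ → time (k + 1) ω = ∞
  first_deterministic : ∃ t : ℝ≥0∞, 0 < t ∧ ∀ ω, time 1 ω = t
  measurable_history : ∀ j, 1 ≤ j → Measurable[history X time j] (time (j + 1))

variable {α : ℝ}

lemma DisorderModel.measurable_X (M : DisorderModel P p lam) (t : ℝ≥0) :
    Measurable (M.X α t) := by
  have h1 := M.measurable_W t
  have h2 := M.measurable_Θ
  unfold DisorderModel.X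
  fun_prop

lemma DisorderModel.continuous_X (M : DisorderModel P p lam) (ω : Ω) :
    Continuous fun t => M.X α t ω := by
  have h1 := M.continuous_W ω
  unfold DisorderModel.X
  fun_prop

lemma DisorderModel.measurable_observed (M : DisorderModel P p lam) {T : Ω → ℝ≥0∞}
    (hT : Measurable T) : Measurable (observed (M.X α) T) := by
  have h : Measurable (Function.uncurry (M.X α)) :=
    measurable_uncurry_of_continuous_of_measurable M.continuous_X M.measurable_X
  have h2 : Measurable fun ω => M.X α (T ω).toNNReal ω :=
    h.comp (hT.ennreal_toNNReal.prodMk measurable_id)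
  exact Measurable.ite (hT (measurableSet_singleton _)) measurable_const h2

lemma ObsSeq.measurable_time (M : DisorderModel P p lam) (s : ObsSeq (M.X α)) (k : ℕ) :
    Measurable (s.time k) := by
  induction k using Nat.strong_induction_on with
  | _ k ih =>
    match k, ih with
    | 0, _ => simp [funext s.time_zero]
    | 1, _ =>
      obtain ⟨t, -, ht⟩ := s.first_deterministic
      simp [funext ht]
    | j + 2, ih =>
      refine (s.measurable_history (j + 1) (by omega)).mono ?_ le_rfl
      refine iSup₂_le fun i hi => ?_
      have hi' : Measurable (s.time i) := ih i (by simp at hi; omega)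
      exact (hi'.prodMk (M.measurable_observed hi')).comap_le

lemma ObsSeq.measurable_record (M : DisorderModel P p lam) (s : ObsSeq (M.X α)) (i : ℕ) (t : ℝ≥0) :
    Measurable (record (M.X α) s.time i t) :=
  Measurable.ite (measurableSet_le (s.measurable_time M i) measurable_const)
    ((s.measurable_time M i).prodMk (M.measurable_observed (s.measurable_time M i)))
    measurable_const

/-- The observation filtration `𝓕_t = σ(X_{τ_1}, …, X_{τ_j}, τ_1, …, τ_j)`, `j = sup {k : τ_k ≤ t}`:
the information in the random list of the observations made up to time `t`. -/
def obsFiltration (M : DisorderModel P p lam) (s : ObsSeq (M.X α)) :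
    Filtration ℝ≥0 ‹MeasurableSpace Ω› where
  seq t := ⨆ i : ℕ, MeasurableSpace.comap (record (M.X α) s.time (i + 1) t) inferInstance
  mono' r t h := by
    refine iSup_mono fun i => ?_
    rw [record_of_le _ _ _ h, ← MeasurableSpace.comap_comp]
    refine MeasurableSpace.comap_mono (Measurable.comap_le ?_)
    exact Measurable.ite (measurableSet_le measurable_fst measurable_const) measurable_id
      measurable_const
  le' t := iSup_le fun i => (s.measurable_record M (i + 1) t).comap_le

/-- `τ ∈ 𝒮^τ̂`: `τ` is a (possibly infinite) stopping time of the observation filtration. -/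
def IsObsStopping (M : DisorderModel P p lam) (s : ObsSeq (M.X α)) (τ : Ω → ℝ≥0∞) : Prop :=
  IsStoppingTime (obsFiltration M s) τ

/-- `τ ∈ 𝒮₀^τ̂`: moreover, almost surely `τ = τ_k` for some random `k ≥ 0` (with `τ_0 = 0`). -/
def IsObsStopping₀ (M : DisorderModel P p lam) (s : ObsSeq (M.X α)) (τ : Ω → ℝ≥0∞) : Prop :=
  IsObsStopping M s τ ∧ ∀ᵐ ω ∂P, ∃ k, τ ω = s.time k ω

/-- The number `∑_{k ≥ 1} 1_{τ_k ≤ τ}` of observations made up to time `τ`. -/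
def numObs {X : ℝ≥0 → Ω → ℝ} (s : ObsSeq X) (τ : Ω → ℝ≥0∞) (ω : Ω) : ℝ≥0∞ :=
  ∑' k : ℕ, if s.time (k + 1) ω ≤ τ ω then 1 else 0

/-- The Bayes risk `P(τ < Θ) + E[c (τ - Θ)⁺ + d ∑_{k ≥ 1} 1_{τ_k ≤ τ}]`; subtraction in `ℝ≥0∞` is
the positive part of the difference. -/
def risk (M : DisorderModel P p lam) (c d : ℝ) (s : ObsSeq (M.X α)) (τ : Ω → ℝ≥0∞) : ℝ≥0∞ :=
  P {ω | τ ω < M.Θ ω} +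
    ∫⁻ ω, (ENNReal.ofReal c * (τ ω - M.Θ ω) + ENNReal.ofReal d * numObs s τ ω) ∂P

/-- The value `V` of the quickest detection problem with costly observations. -/
def value (M : DisorderModel P p lam) (α c d : ℝ) : ℝ≥0∞ :=
  ⨅ (s : ObsSeq (M.X α)) (τ : Ω → ℝ≥0∞) (_ : IsObsStopping M s τ), risk M c d s τ

/-- `Q` is (a right-continuous version of) the a posteriori probability process
`Π_t = P(Θ ≤ t | 𝓕_t)`. -/
structure IsPosterior (M : DisorderModel P p lam) (s : ObsSeq (M.X α)) (Q : ℝ≥0 → Ω → ℝ) :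
    Prop where
  adapted : Adapted (obsFiltration M s) Q
  rightContinuous : ∀ ω t, ContinuousWithinAt (fun u => Q u ω) (Ici t) t
  condProb : ∀ t : ℝ≥0, Q t =ᵐ[P]
    P[({ω | M.Θ ω ≤ t}.indicator fun _ => (1 : ℝ)) | obsFiltration M s t]

/-- The posterior probability at time `t` started from `q` if no observation is ever made. -/
def noObsPosterior (lam q t : ℝ) : ℝ := 1 - (1 - q) * Real.exp (-lam * t)

/-- The minimal cost `F(q) = inf_{t ≥ 0} {1 - Π_t + c ∫₀ᵗ Π_s ds}` of stopping without any
observation, the posterior starting from `q`. -/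
def noObsCost (lam c q : ℝ) : ℝ :=
  ⨅ t : ℝ≥0, (1 - noObsPosterior lam q t + c * ∫ u in (0 : ℝ)..t, noObsPosterior lam q u)

/-- `e^{-lam r}` for `r ∈ [0, ∞]`, with value `0` at `r = ∞`. -/
def discount (lam : ℝ) (r : ℝ≥0∞) : ℝ := if r = ∞ then 0 else Real.exp (-lam * r.toReal)

/-- The sum `∑_{k ≥ 0} (1 - Π_{τ_k}) (1 - e^{-lam (τ_{k+1} - τ_k)}) 1_{τ_{k+1} ≤ τ}`. -/
def discountSum {X : ℝ≥0 → Ω → ℝ} (lam : ℝ) (s : ObsSeq X) (Q : ℝ≥0 → Ω → ℝ) (τ : Ω → ℝ≥0∞)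
    (ω : Ω) : ℝ≥0∞ :=
  ∑' k : ℕ, if s.time (k + 1) ω ≤ τ ω then
    ENNReal.ofReal ((1 - Q (s.time k ω).toNNReal ω) *
      (1 - discount lam (s.time (k + 1) ω - s.time k ω))) else 0

/-- The random cost
`F(Π_τ) + c τ - (c / lam) ∑_{k ≥ 0} (1 - Π_{τ_k}) (1 - e^{-lam (τ_{k+1} - τ_k)}) 1_{τ_{k+1} ≤ τ}`
`+ d ∑_{k ≥ 1} 1_{τ_k ≤ τ}`.
For `τ = τ_m` with `Π` in `[0, 1]` at observation times, the subtracted term is finite, so that no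
expression `∞ - ∞` occurs. The value used for `Π_τ` where `τ = ∞` is irrelevant: the cost is `∞`. -/
def reducedCost {X : ℝ≥0 → Ω → ℝ} (lam c d : ℝ) (s : ObsSeq X) (Q : ℝ≥0 → Ω → ℝ) (τ : Ω → ℝ≥0∞)
    (ω : Ω) : EReal :=
  (noObsCost lam c (Q (τ ω).toNNReal ω) : EReal) + ((ENNReal.ofReal c * τ ω : ℝ≥0∞) : EReal)
    - ((ENNReal.ofReal (c / lam) * discountSum lam s Q τ ω : ℝ≥0∞) : EReal)
    + ((ENNReal.ofReal d * numObs s τ ω : ℝ≥0∞) : EReal)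

/-- The expectation `E[Z] = E[Z⁺] - E[Z⁻]` of an extended real random variable. -/
def expectation (P : Measure Ω) (Z : Ω → EReal) : EReal :=
  ((∫⁻ ω, (Z ω).toENNReal ∂P : ℝ≥0∞) : EReal) - ((∫⁻ ω, (-Z ω).toENNReal ∂P : ℝ≥0∞) : EReal)

end

end CostlyDisorder

end

/-! Everything rests on one fact: between observations the posterior moves deterministically. Up to
Θ the path of X is that of W, which is independent of Θ. Hence, given the first k observations and
τ_k < Θ, the remaining delay Θ - τ_k is still exponential (`ObsSeq.lintegral_memoryless`), and by
time τ_k + r the conditional probability of no disorder is (1 - Π_{τ_k}) e^{-λr}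
(`measure_inter_lt_Θ`).

Let N be the number of observations made up to a stopping time τ. On {N = m} the time τ is a
function of the first m observations (`IsObsStopping.measurable_indicator`), so one may condition
stage by stage (`measure_lt_add_lintegral_delay`). The risk becomes the expectation of the cost of
waiting for τ - τ_N from the posterior Π_{τ_N}, plus c times the expected post-disorder time in each
completed interval, plus dN. An interval of length Δ contributes Δ - (1 - Π)(1 - e^{-λΔ})/λ; the
lengths telescope to τ_N, which produces the reduced cost with the waiting cost in place of F.

The waiting cost is at least F, so moving τ back to τ_N gives one inequality. For the other, all
observations after τ are dropped and the deterministic minimiser `optTime` is waited out: this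
attains F and costs no further observation. Since d > 0, infinitely many observations have infinite
cost on either side. -/

noncomputable section

namespace CostlyDisorder

/-! ### Lists of observations and the σ-algebras they generate -/

section Observations

variable {Ω : Type*} {X : ℝ≥0 → Ω → ℝ}

/-- Sequences of (time, value) pairs, the placeholder `(∞, 0)` standing for a missing entry. -/
abbrev Obs : Type := ℕ → ℝ≥0∞ × ℝ

/-- The first `k` observations. -/
def hist (X : ℝ≥0 → Ω → ℝ) (τ : ℕ → Ω → ℝ≥0∞) (k : ℕ∞) (ω : Ω) : Obs := fun i =>
  if (i : ℕ∞) < k then (τ (i + 1) ω, observed X (τ (i + 1)) ω) else (∞, 0)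

/-- The observations made up to time `t`. -/
def recs (X : ℝ≥0 → Ω → ℝ) (τ : ℕ → Ω → ℝ≥0∞) (t : ℝ≥0) (ω : Ω) : Obs := fun i =>
  record X τ (i + 1) t ω

/-- The entries made up to time `r`. -/
def truncTime (r : ℝ≥0) (e : Obs) : Obs := fun i => if (e i).1 ≤ r then e i else (∞, 0)

/-- The first `k` entries. -/
def truncIdx (k : ℕ∞) (e : Obs) : Obs := fun i => if (i : ℕ∞) < k then e i else (∞, 0)

lemma measurable_truncTime (r : ℝ≥0) : Measurable (truncTime r) := by
  refine measurable_pi_lambda _ fun i => ?_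
  exact Measurable.ite (measurableSet_le ((measurable_pi_apply i).fst) measurable_const)
    (measurable_pi_apply i) measurable_const

lemma measurable_truncIdx (k : ℕ∞) : Measurable (truncIdx k) := by
  refine measurable_pi_lambda _ fun i => ?_
  unfold truncIdx
  split_ifs
  · exact measurable_pi_apply i
  · exact measurable_const

lemma comap_hist_eq (τ : ℕ → Ω → ℝ≥0∞) (j : ℕ) :
    MeasurableSpace.comap (hist X τ j) inferInstance = history X τ j := by
  apply le_antisymm
  · rw [← measurable_iff_comap_le]
    let _ := history X τ j
    refine measurable_pi_lambda _ fun i => ?_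
    unfold hist
    split_ifs with h
    · have h' : i + 1 ≤ j := by exact_mod_cast h
      have : MeasurableSpace.comap (fun ω => (τ (i + 1) ω, observed X (τ (i + 1)) ω)) inferInstance
          ≤ history X τ j :=
        le_iSup₂_of_le (f := fun i (_ : i ∈ Finset.Icc 1 j) => MeasurableSpace.comap
          (fun ω => (τ i ω, observed X (τ i) ω)) inferInstance) (i + 1) (by simp; omega) le_rfl
      exact (comap_measurable _).mono this le_rfl
    · exact measurable_const
  · refine iSup₂_le fun i hi => ?_
    obtain ⟨h1, h2⟩ := Finset.mem_Icc.1 hi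
    obtain ⟨i, rfl⟩ : ∃ l, i = l + 1 := ⟨i - 1, by omega⟩
    have h : (fun ω => (τ (i + 1) ω, observed X (τ (i + 1)) ω)) =
        (fun e : Obs => e i) ∘ hist X τ j := by
      funext ω
      have : (i : ℕ∞) < j := by exact_mod_cast h2
      simp [hist, this]
    rw [h, ← MeasurableSpace.comap_comp]
    exact MeasurableSpace.comap_mono (measurable_pi_apply i).comap_le

lemma hist_eq_truncIdx (τ : ℕ → Ω → ℝ≥0∞) {j k : ℕ∞} (h : j ≤ k) :
    hist X τ j = truncIdx j ∘ hist X τ k := by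
  funext ω i
  by_cases hi : (i : ℕ∞) < j
  · simp [hist, truncIdx, hi, hi.trans_le h]
  · simp [hist, truncIdx, hi]

lemma comap_hist_mono (τ : ℕ → Ω → ℝ≥0∞) {j k : ℕ∞} (h : j ≤ k) :
    MeasurableSpace.comap (hist X τ j) inferInstance ≤
      MeasurableSpace.comap (hist X τ k) inferInstance := by
  rw [hist_eq_truncIdx τ h, ← MeasurableSpace.comap_comp]
  exact MeasurableSpace.comap_mono (measurable_truncIdx j).comap_le

namespace ObsSeq

variable (s : ObsSeq X)

lemma monotone_time (ω : Ω) : Monotone fun k => s.time k ω := by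
  refine monotone_nat_of_le_succ fun k => ?_
  by_cases h : s.time k ω = ∞
  · rw [s.top_succ k ω h]; exact le_top
  · exact (s.lt_succ k ω h).le

open Classical in
/-- The number of observations made up to time `u`. -/
def count (u : ℝ≥0∞) (ω : Ω) : ℕ∞ :=
  if h : ∃ k, u < s.time (k + 1) ω then (Nat.find h : ℕ) else ⊤

/-- Entry i of a list is observation i + 1, whence the shift. By monotonicity of the times, the
first index violating the bound separates the observations made from the others. At u = ∞ the count
is always ⊤. -/
lemma lt_count_iff {u : ℝ≥0∞} {ω : Ω} {i : ℕ} :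
    (i : ℕ∞) < s.count u ω ↔ s.time (i + 1) ω ≤ u := by
  classical
  unfold count
  split_ifs with h
  · rw [Nat.cast_lt, Nat.lt_find_iff]
    refine ⟨fun hi => not_lt.1 (hi i le_rfl), fun hi m hm => not_lt.2 (le_trans ?_ hi)⟩
    exact s.monotone_time ω (by omega)
  · push Not at h
    simpa using h i

lemma count_le_iff {u : ℝ≥0∞} {ω : Ω} {k : ℕ} :
    s.count u ω ≤ k ↔ u < s.time (k + 1) ω := by
  rw [← not_lt, lt_count_iff, not_le]

lemma le_count_iff {u : ℝ≥0∞} {ω : Ω} {k : ℕ} :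
    (k : ℕ∞) ≤ s.count u ω ↔ s.time k ω ≤ u := by
  cases k with
  | zero => simp [s.time_zero]
  | succ k => rw [← lt_count_iff, Nat.cast_succ, ENat.add_one_le_iff (by simp)]

lemma count_eq_coe_iff {u : ℝ≥0∞} {ω : Ω} {k : ℕ} :
    s.count u ω = k ↔ s.time k ω ≤ u ∧ u < s.time (k + 1) ω := by
  rw [← le_count_iff, ← count_le_iff, le_antisymm_iff, and_comm]

lemma count_time {k : ℕ} {ω : Ω} (h : s.time k ω ≠ ∞) : s.count (s.time k ω) ω = k :=
  s.count_eq_coe_iff.2 ⟨le_rfl, s.lt_succ k ω h⟩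

lemma recs_apply (r : ℝ≥0) (ω : Ω) (i : ℕ) : recs X s.time r ω i =
    if (i : ℕ∞) < s.count r ω then (s.time (i + 1) ω, observed X (s.time (i + 1)) ω)
      else (∞, 0) := by
  simp [recs, record, lt_count_iff]

lemma recs_eq_hist (r : ℝ≥0) (ω : Ω) :
    recs X s.time r ω = hist X s.time (s.count r ω) ω := by
  funext i
  rw [recs_apply]; rfl

lemma recs_eq_truncTime {r : ℝ≥0} {ω : Ω} {k : ℕ∞} (h : s.count r ω ≤ k) :
    recs X s.time r ω = truncTime r (hist X s.time k ω) := by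
  funext i
  rw [recs_apply]
  by_cases hi : (i : ℕ∞) < s.count r ω
  · have := s.lt_count_iff.1 hi
    simp [hist, truncTime, hi, hi.trans_le h, this]
  · have h' : ¬ s.time (i + 1) ω ≤ r := fun h' => hi (s.lt_count_iff.2 h')
    by_cases hk : (i : ℕ∞) < k <;> simp [hist, truncTime, hi, hk, h']

lemma hist_eq_truncIdx_recs {r : ℝ≥0} {ω : Ω} {k : ℕ∞} (h : k ≤ s.count r ω) :
    hist X s.time k ω = truncIdx k (recs X s.time r ω) := by
  rw [s.recs_eq_hist, hist_eq_truncIdx s.time h]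
  rfl

/-- The σ-algebra of the observations made up to time `r`. -/
@[reducible] def recσ (r : ℝ≥0) : MeasurableSpace Ω :=
  MeasurableSpace.comap (recs X s.time r) inferInstance

/-- The σ-algebra of the first `k` observations. -/
@[reducible] def histσ (k : ℕ∞) : MeasurableSpace Ω :=
  MeasurableSpace.comap (hist X s.time k) inferInstance

lemma measurableSet_le_count (r : ℝ≥0) (k : ℕ∞) :
    MeasurableSet[s.recσ r] {ω | k ≤ s.count r ω} := by
  have : {ω | k ≤ s.count r ω} = recs X s.time r ⁻¹'
      ⋂ (i : ℕ) (_ : (i : ℕ∞) < k), {e | (e i).1 ≤ r} := by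
    ext ω
    simp only [mem_ofPred_eq, mem_preimage, mem_iInter]
    constructor
    · intro h i hi
      have := s.lt_count_iff.1 (hi.trans_le h)
      simpa [recs_apply, hi.trans_le h] using this
    · intro h
      by_contra! hk
      obtain ⟨i, hi⟩ := ENat.ne_top_iff_exists.1 (ne_top_of_lt hk)
      have := h i (hi ▸ hk)
      rw [recs_apply, if_neg (by rw [hi]; exact lt_irrefl _)] at this
      simp at this
  rw [this]
  refine ⟨_, ?_, rfl⟩
  refine MeasurableSet.iInter fun i => MeasurableSet.iInter fun _ => ?_
  exact measurableSet_le ((measurable_pi_apply i).fst) measurable_const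

lemma measurable_time_succ (k : ℕ) : Measurable[s.histσ k] (s.time (k + 1)) := by
  cases k with
  | zero =>
    obtain ⟨t, -, ht⟩ := s.first_deterministic
    rw [show s.time (0 + 1) = fun _ => t from funext ht]
    exact measurable_const
  | succ k =>
    have := s.measurable_history (k + 1) (by omega)
    rwa [← comap_hist_eq] at this

lemma measurable_time_of_le {j : ℕ} {k : ℕ∞} (h : (j : ℕ∞) ≤ k + 1) :
    Measurable[s.histσ k] (s.time j) := by
  cases j with
  | zero =>
    rw [show s.time 0 = fun _ => 0 from funext s.time_zero]
    exact measurable_const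
  | succ j =>
    have h' : (j : ℕ∞) ≤ k := by
      rw [Nat.cast_succ] at h
      exact (ENat.add_le_add_iff_right (by simp)).1 h
    exact (s.measurable_time_succ j).mono (comap_hist_mono s.time h') le_rfl

lemma measurableSet_count_le (r : ℝ≥0) (k : ℕ∞) :
    MeasurableSet[s.histσ k] {ω | s.count r ω ≤ k} := by
  cases k with
  | top => simp
  | coe k =>
    simp only [count_le_iff]
    let _ := s.histσ k
    exact measurableSet_lt measurable_const (s.measurable_time_succ k)

/-- When at most k observations are made by time r, the records at r are the first k observations
with the entries later than r erased. The next lemma is the converse: when at least k are made,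
truncating the records to k entries recovers the first k observations. -/
lemma measurableSet_hist_of_recs {S : Set Ω} {r : ℝ≥0} (k : ℕ∞) (hS : MeasurableSet[s.recσ r] S) :
    MeasurableSet[s.histσ k] (S ∩ {ω | s.count r ω ≤ k}) := by
  obtain ⟨B, hB, rfl⟩ := hS
  have : recs X s.time r ⁻¹' B ∩ {ω | s.count r ω ≤ k} =
      hist X s.time k ⁻¹' (truncTime r ⁻¹' B) ∩ {ω | s.count r ω ≤ k} := by
    ext ω
    simp only [mem_inter_iff, mem_preimage, mem_ofPred_eq, and_congr_left_iff]
    intro h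
    rw [s.recs_eq_truncTime h]
  rw [this]
  exact MeasurableSet.inter ⟨_, measurable_truncTime r hB, rfl⟩ (s.measurableSet_count_le r k)

lemma measurableSet_recs_of_hist {S : Set Ω} (r : ℝ≥0) {k : ℕ∞} (hS : MeasurableSet[s.histσ k] S) :
    MeasurableSet[s.recσ r] (S ∩ {ω | k ≤ s.count r ω}) := by
  obtain ⟨B, hB, rfl⟩ := hS
  have : hist X s.time k ⁻¹' B ∩ {ω | k ≤ s.count r ω} =
      recs X s.time r ⁻¹' (truncIdx k ⁻¹' B) ∩ {ω | k ≤ s.count r ω} := by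
    ext ω
    simp only [mem_inter_iff, mem_preimage, mem_ofPred_eq, and_congr_left_iff]
    intro h
    rw [s.hist_eq_truncIdx_recs h]
  rw [this]
  exact MeasurableSet.inter ⟨_, measurable_truncIdx k hB, rfl⟩ (s.measurableSet_le_count r k)

end ObsSeq

end Observations

/-! ### Stopping times as functions of finitely many observations -/

section Stopping

variable {Ω : Type*} [MeasurableSpace Ω] {P : Measure Ω} {p lam α : ℝ}
  (M : DisorderModel P p lam) (s : ObsSeq (M.X α))

lemma obsFiltration_eq (t : ℝ≥0) : obsFiltration M s t = s.recσ t := by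
  change (⨆ i : ℕ, MeasurableSpace.comap (record (M.X α) s.time (i + 1) t) inferInstance) = _
  unfold ObsSeq.recσ
  rw [show (inferInstance : MeasurableSpace Obs) = MeasurableSpace.pi from rfl]
  simp only [MeasurableSpace.pi, MeasurableSpace.comap_iSup, MeasurableSpace.comap_comp]
  rfl

lemma ObsSeq.measurable_hist (k : ℕ∞) : Measurable (hist (M.X α) s.time k) := by
  refine measurable_pi_lambda _ fun i => ?_
  unfold hist
  split_ifs
  · exact (s.measurable_time M _).prodMk (M.measurable_observed (s.measurable_time M _))
  · exact measurable_const

lemma ObsSeq.histσ_le (k : ℕ∞) : s.histσ k ≤ ‹MeasurableSpace Ω› := (s.measurable_hist M k).comap_le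

variable {M s} {τ : Ω → ℝ≥0∞}

/-- τ < τ_{k+1} means that τ ≤ r < τ_{k+1} for some r in a countable dense set, and as long as r <
τ_{k+1} the event {τ ≤ r} is decided by the first k observations. -/
lemma IsObsStopping.measurableSet_lt (hτ : IsObsStopping M s τ) (k : ℕ) :
    MeasurableSet[s.histσ k] {ω | τ ω < s.time (k + 1) ω} := by
  have : {ω | τ ω < s.time (k + 1) ω} =
      ⋃ r ∈ (TopologicalSpace.exists_countable_dense ℝ≥0).choose,
        {ω | τ ω ≤ (r : ℝ≥0∞)} ∩ {ω | s.count r ω ≤ k} := by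
    have hd := (TopologicalSpace.exists_countable_dense ℝ≥0).choose_spec.2
    ext ω
    simp only [mem_ofPred_eq, mem_iUnion, mem_inter_iff, ObsSeq.count_le_iff, exists_prop]
    constructor
    · intro h
      obtain ⟨q, hq1, hq2⟩ := ENNReal.lt_iff_exists_nnreal_btwn.1 h
      obtain ⟨q', hq1', hq2'⟩ := ENNReal.lt_iff_exists_nnreal_btwn.1 hq2
      obtain ⟨r, hr, hr'⟩ := hd.exists_between (ENNReal.coe_lt_coe.1 hq1')
      exact ⟨r, hr, (hq1.trans (by exact_mod_cast hr'.1)).le,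
        lt_trans (by exact_mod_cast hr'.2) hq2'⟩
    · rintro ⟨r, -, h1, h2⟩
      exact h1.trans_lt h2
  rw [this]
  refine MeasurableSet.biUnion (TopologicalSpace.exists_countable_dense ℝ≥0).choose_spec.1
    fun r _ => ?_
  have := hτ r
  rw [obsFiltration_eq] at this
  exact s.measurableSet_hist_of_recs k this

lemma IsObsStopping.measurableSet_time_le (hτ : IsObsStopping M s τ) {j : ℕ} {k : ℕ∞}
    (h : (j : ℕ∞) ≤ k + 1) : MeasurableSet[s.histσ k] {ω | s.time j ω ≤ τ ω} := by
  cases j with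
  | zero => simp [s.time_zero]
  | succ j =>
    have h' : (j : ℕ∞) ≤ k := by
      rw [Nat.cast_succ] at h
      exact (ENat.add_le_add_iff_right (by simp)).1 h
    have : {ω | s.time (j + 1) ω ≤ τ ω} = {ω | τ ω < s.time (j + 1) ω}ᶜ := by
      ext; simp
    rw [this]
    exact (comap_hist_mono s.time h' _ (hτ.measurableSet_lt j)).compl

lemma IsObsStopping.measurableSet_count_eq (hτ : IsObsStopping M s τ) (k : ℕ) :
    MeasurableSet[s.histσ k] {ω | s.count (τ ω) ω = k} := by
  simp only [ObsSeq.count_eq_coe_iff]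
  exact (hτ.measurableSet_time_le (by exact_mod_cast k.le_succ)).inter (hτ.measurableSet_lt k)

lemma IsObsStopping.measurable_indicator (hτ : IsObsStopping M s τ) (k : ℕ) :
    Measurable[s.histσ k] ({ω | s.count (τ ω) ω = k}.indicator τ) := by
  refine @measurable_of_Iic _ _ _ _ _ (s.histσ k) _ _ _ _ fun x => ?_
  induction x with
  | top => simp
  | coe r =>
    -- On {count = k} one has τ < τ_{k+1}. If τ_{k+1} ≤ r, then τ ≤ r holds automatically; otherwise
    -- {τ ≤ r} is known from the first k observations.
    have : {ω | s.count (τ ω) ω = k}.indicator τ ⁻¹' Iic (r : ℝ≥0∞) =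
        {ω | s.count (τ ω) ω = k}ᶜ ∪ (({ω | τ ω ≤ (r : ℝ≥0∞)} ∩ {ω | s.count r ω ≤ k}) ∪
          {ω | s.count r ω ≤ k}ᶜ) := by
      ext ω
      by_cases h : s.count (τ ω) ω = k
      · have h2 := (s.count_eq_coe_iff.1 h).2
        simp only [mem_preimage, mem_union, mem_compl_iff, mem_ofPred_eq, h, mem_inter_iff,
          indicator_of_mem (show ω ∈ {ω | s.count (τ ω) ω = k} from h), s.count_le_iff, mem_Iic]
        by_cases h3 : (r : ℝ≥0∞) < s.time (k + 1) ω
        · simp [h3]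
        · simpa [h3] using h2.le.trans (not_lt.1 h3)
      · simp [indicator, h]
    rw [this]
    have h1 := hτ r
    rw [obsFiltration_eq] at h1
    exact (hτ.measurableSet_count_eq k).compl.union
      ((s.measurableSet_hist_of_recs k h1).union (s.measurableSet_count_le r k).compl)

end Stopping

/-! ### Existence and uniqueness of the right-continuous posterior -/

section Posterior

lemma continuousWithinAt_measureReal_Iic (μ : Measure ℝ≥0) [IsProbabilityMeasure μ] (t : ℝ≥0) :
    ContinuousWithinAt (fun u => μ.real (Iic u)) (Ici t) t := by
  have : IsProbabilityMeasure (μ.map NNReal.toReal) :=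
    Measure.isProbabilityMeasure_map NNReal.continuous_coe.aemeasurable
  have h : (fun u : ℝ≥0 => μ.real (Iic u)) = fun u : ℝ≥0 => cdf (μ.map NNReal.toReal) (u : ℝ) := by
    funext u
    rw [cdf_eq_real, map_measureReal_apply NNReal.continuous_coe.measurable measurableSet_Iic]
    rfl
  rw [h]
  exact ((cdf (μ.map NNReal.toReal)).right_continuous t).comp
    NNReal.continuous_coe.continuousWithinAt fun u hu => by exact_mod_cast hu

lemma eq_of_dense_of_rightContinuous {f g : ℝ≥0 → ℝ} {D : Set ℝ≥0} (hD : Dense D)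
    (hf : ∀ t, ContinuousWithinAt f (Ici t) t) (hg : ∀ t, ContinuousWithinAt g (Ici t) t)
    (h : ∀ t ∈ D, f t = g t) (t : ℝ≥0) : f t = g t := by
  by_contra hne
  have h1 : ∀ᶠ u in 𝓝[≥] t, f u - g u ≠ 0 :=
    ((hf t).sub (hg t)).eventually_ne (sub_ne_zero.2 hne)
  obtain ⟨v, hv, hsub⟩ := (mem_nhdsGE_iff_exists_Ico_subset' (lt_add_one t)).1 h1
  obtain ⟨r, hr, htr, hrv⟩ := hD.exists_between (show t < v from hv)
  exact hsub ⟨htr.le, hrv⟩ (sub_eq_zero.2 (h r hr))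

variable {Ω : Type*} [MeasurableSpace Ω] {P : Measure Ω} {p lam α : ℝ}
  (M : DisorderModel P p lam) (s : ObsSeq (M.X α))

/-- Almost sure equality at countably many dense times extends to all times by right-continuity.
Equality at fixed times would not suffice, because the posterior is evaluated at random times. -/
lemma IsPosterior.indistinguishable {M : DisorderModel P p lam} {s : ObsSeq (M.X α)}
    {Q Q' : ℝ≥0 → Ω → ℝ} (h : IsPosterior M s Q) (h' : IsPosterior M s Q') :
    ∀ᵐ ω ∂P, ∀ t, Q t ω = Q' t ω := by
  obtain ⟨D, hDc, hDd⟩ := TopologicalSpace.exists_countable_dense ℝ≥0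
  have : ∀ᵐ ω ∂P, ∀ t ∈ D, Q t ω = Q' t ω :=
    (ae_ball_iff hDc).2 fun t _ => (h.condProb t).trans (h'.condProb t).symm
  filter_upwards [this] with ω hω t
  exact eq_of_dense_of_rightContinuous hDd (h.rightContinuous ω) (h'.rightContinuous ω) hω t

lemma measurableSet_count_le_recσ (t : ℝ≥0) (k : ℕ∞) :
    MeasurableSet[s.recσ t] {ω | s.count t ω ≤ k} := by
  cases k with
  | top => simp
  | coe k =>
    have : {ω | s.count t ω ≤ k} = {ω | ((k + 1 : ℕ) : ℕ∞) ≤ s.count t ω}ᶜ := by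
      ext ω
      simp [s.count_le_iff, s.le_count_iff, -Nat.cast_add]
    rw [this]
    exact (s.measurableSet_le_count t _).compl

lemma inter_count_eq (S : Set Ω) (t : ℝ≥0) (k : ℕ∞) : {ω | s.count t ω = k} ∩ S =
    (S ∩ {ω | k ≤ s.count t ω}) ∩ {ω | s.count t ω ≤ k} := by
  ext ω
  simp only [mem_inter_iff, mem_ofPred_eq, le_antisymm_iff]
  tauto

lemma measurableSet_count_eq_recσ (t : ℝ≥0) (k : ℕ∞) :
    MeasurableSet[s.recσ t] {ω | s.count t ω = k} := by
  have := inter_count_eq M s univ t k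
  rw [inter_univ, univ_inter] at this
  rw [this]
  exact (s.measurableSet_le_count t k).inter (measurableSet_count_le_recσ M s t k)

/-- On {count = k} the filtration at t and the first k observations carry the same information, so
conditional expectations given either agree there. -/
lemma measurableSet_inter_count_iff (S : Set Ω) (t : ℝ≥0) (k : ℕ∞) :
    MeasurableSet[s.recσ t] ({ω | s.count t ω = k} ∩ S) ↔
      MeasurableSet[s.histσ k] ({ω | s.count t ω = k} ∩ S) := by
  constructor <;> intro h
  · have h' := s.measurableSet_hist_of_recs k h
    rwa [inter_eq_left.2 fun ω hω => hω.1.le] at h'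
  · have h' := s.measurableSet_recs_of_hist t h
    rwa [inter_eq_left.2 fun ω hω => hω.1.ge] at h'

variable [IsProbabilityMeasure P]

/-- The conditional probability of `Θ ≤ u` given the first `k` observations. -/
def posteriorAt (k : ℕ∞) (u : ℝ≥0) (ω : Ω) : ℝ :=
  (condDistrib M.Θ (hist (M.X α) s.time k) P (hist (M.X α) s.time k ω)).real (Iic u)

/-- A right-continuous version of the a posteriori probability process. -/
def posterior (t : ℝ≥0) (ω : Ω) : ℝ := posteriorAt M s (s.count t ω) t ω

lemma posteriorAt_nonneg (k : ℕ∞) (u : ℝ≥0) (ω : Ω) : 0 ≤ posteriorAt M s k u ω :=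
  measureReal_nonneg

lemma posteriorAt_le_one (k : ℕ∞) (u : ℝ≥0) (ω : Ω) : posteriorAt M s k u ω ≤ 1 :=
  measureReal_le_one

lemma measurable_posteriorAt (k : ℕ∞) (u : ℝ≥0) : Measurable[s.histσ k] (posteriorAt M s k u) :=
  (measurable_condDistrib measurableSet_Iic).ennreal_toReal

/-- A regular conditional distribution of Θ given the first k observations is used while k
observations have been made: for fixed ω its distribution function is right-continuous in time, and
the number of observations is constant just to the right of t. The value k = ⊤ is needed because
observation times may accumulate. -/
lemma isPosterior_posterior : IsPosterior M s (posterior M s) where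
  adapted t := by
    rw [obsFiltration_eq]
    intro B hB
    have : posterior M s t ⁻¹' B =
        ⋃ k : ℕ∞, {ω | s.count t ω = k} ∩ posteriorAt M s k t ⁻¹' B := by
      ext ω
      simp [posterior]
    rw [this]
    refine MeasurableSet.iUnion fun k => ?_
    rw [inter_count_eq M s]
    exact (s.measurableSet_recs_of_hist t (measurable_posteriorAt M s k t hB)).inter
      (measurableSet_count_le_recσ M s t k)
  rightContinuous ω t := by
    have h : ∀ᶠ u : ℝ≥0 in 𝓝[≥] t, s.count u ω = s.count t ω := by
      rcases eq_or_ne (s.count t ω) ⊤ with h | h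
      · filter_upwards [self_mem_nhdsWithin] with u hu
        rw [h, ENat.eq_top_iff_forall_ge]
        intro k
        rw [s.le_count_iff]
        exact (s.le_count_iff.1 (h ▸ le_top)).trans (by exact_mod_cast hu)
      · obtain ⟨k, hk⟩ := ENat.ne_top_iff_exists.1 h
        have h1 := s.count_eq_coe_iff.1 hk.symm
        have h2 : ∀ᶠ u : ℝ≥0 in 𝓝[≥] t, (u : ℝ≥0∞) < s.time (k + 1) ω :=
          (ENNReal.continuous_coe.tendsto t |>.mono_left nhdsWithin_le_nhds).eventually_lt_const
            h1.2
        filter_upwards [h2, self_mem_nhdsWithin] with u hu1 hu2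
        rw [← hk, s.count_eq_coe_iff]
        exact ⟨h1.1.trans (by exact_mod_cast hu2), hu1⟩
    refine (continuousWithinAt_measureReal_Iic
      (condDistrib M.Θ (hist (M.X α) s.time (s.count t ω)) P
        (hist (M.X α) s.time (s.count t ω) ω)) t).congr_of_eventuallyEq ?_ rfl
    filter_upwards [h] with u hu
    simp [posterior, posteriorAt, hu]
  condProb t := by
    have h : ∀ k : ℕ∞, posterior M s t =ᵐ[P.restrict {ω | s.count t ω = k}]
        P[({ω | M.Θ ω ≤ t}.indicator fun _ => (1 : ℝ)) | obsFiltration M s t] := by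
      intro k
      have hm : MeasurableSet[obsFiltration M s t] {ω | s.count t ω = k} := by
        rw [obsFiltration_eq]; exact measurableSet_count_eq_recσ M s t k
      have h1 := condExp_ae_eq_restrict_of_measurableSpace_eq_on (μ := P)
        (f := {ω | M.Θ ω ≤ t}.indicator fun _ => (1 : ℝ))
        ((obsFiltration M s).le t) (s.histσ_le M k) hm fun S => by
          rw [obsFiltration_eq]; exact measurableSet_inter_count_iff M s S t k
      have h2 := condDistrib_ae_eq_condExp (μ := P) (s.measurable_hist M k) M.measurable_Θ
        (measurableSet_Iic (a := t))
      refine Filter.EventuallyEq.trans ?_ h1.symm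
      have h3 : posterior M s t =ᵐ[P.restrict {ω | s.count t ω = k}] posteriorAt M s k t := by
        filter_upwards [ae_restrict_mem ((obsFiltration M s).le t _ hm)] with ω hω
        change posteriorAt M s (s.count t ω) t ω = posteriorAt M s k t ω
        rw [show s.count t ω = k from hω]
      exact h3.trans (ae_restrict_of_ae h2)
    have h' := (ae_eq_restrict_iUnion_iff (μ := P) (fun k : ℕ∞ => {ω | s.count t ω = k}) _ _).2 h
    rwa [show (⋃ k : ℕ∞, {ω | s.count t ω = k}) = univ by ext; simp, Measure.restrict_univ] at h'

lemma lintegral_hist_theta (k : ℕ∞) {φ : Obs × ℝ≥0 → ℝ≥0∞} (hφ : Measurable φ) :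
    ∫⁻ ω, φ (hist (M.X α) s.time k ω, M.Θ ω) ∂P =
      ∫⁻ ω, ∫⁻ θ, φ (hist (M.X α) s.time k ω, θ)
        ∂(condDistrib M.Θ (hist (M.X α) s.time k) P (hist (M.X α) s.time k ω)) ∂P := by
  have hh := s.measurable_hist M k
  rw [← lintegral_map (f := φ) hφ (hh.prodMk M.measurable_Θ),
    ← compProd_map_condDistrib M.measurable_Θ.aemeasurable, Measure.lintegral_compProd hφ,
    lintegral_map ?_ hh]
  exact hφ.lintegral_kernel_prod_right'

end Posterior

/-! ### The exponential discount factor on [0, ∞] -/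

section Discount

lemma measurable_discount (lam : ℝ) : Measurable (discount lam) := by
  unfold discount
  refine Measurable.ite (measurableSet_singleton _) measurable_const ?_
  have := ENNReal.measurable_toReal
  fun_prop

lemma discount_nonneg (lam : ℝ) (r : ℝ≥0∞) : 0 ≤ discount lam r := by
  unfold discount; split_ifs <;> positivity

lemma discount_le_one {lam : ℝ} (hlam : 0 ≤ lam) (r : ℝ≥0∞) : discount lam r ≤ 1 := by
  unfold discount
  split_ifs
  · exact zero_le_one
  · rw [Real.exp_le_one_iff, neg_mul, neg_nonpos]; positivity

/-- The semigroup property of the exponential. It survives r = t = ∞: there ∞ - ∞ = 0 gives the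
factor 1, and both sides vanish. -/
lemma discount_sub_mul (lam : ℝ) {r t : ℝ≥0∞} (h : r ≤ t) :
    discount lam (t - r) * discount lam r = discount lam t := by
  by_cases ht : t = ∞
  · by_cases hr : r = ∞ <;> simp [discount, ht, hr]
  · have hr : r ≠ ∞ := ne_top_of_le_ne_top ht h
    have h1 : t - r ≠ ∞ := ENNReal.sub_ne_top ht
    simp only [discount, ht, hr, h1, if_false]
    rw [← Real.exp_add, ENNReal.toReal_sub_of_le h ht]
    congr 1; ring

end Discount

/-! ### Strategies as feedback rules -/

section Build

variable {Ω : Type*}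

/-- The time of the `k`-th entry, with the convention that the `0`-th time is `0`. -/
def lastTime : ℕ → Obs → ℝ≥0∞
  | 0, _ => 0
  | k + 1, e => (e k).1

lemma measurable_lastTime (k : ℕ) : Measurable (lastTime k) := by
  cases k with
  | zero => exact measurable_const
  | succ k => exact (measurable_pi_apply k).fst

lemma ObsSeq.lastTime_hist {X : ℝ≥0 → Ω → ℝ} (s : ObsSeq X) (k : ℕ) (ω : Ω) :
    lastTime k (hist X s.time k ω) = s.time k ω := by
  cases k with
  | zero => simp [lastTime, s.time_zero]
  | succ k => simp [lastTime, hist, ENat.lt_add_one_iff]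

/-- The observations of the process `Y` when the next observation time is computed from the
previous observations by the feedback rules `f`. -/
def build (f : ℕ → Obs → ℝ≥0∞) (Y : ℝ≥0 → Ω → ℝ) : ℕ → Ω → Obs
  | 0, _ => fun _ => (∞, 0)
  | k + 1, ω => Function.update (build f Y k ω) k
      (f k (build f Y k ω), observed Y (fun ω => f k (build f Y k ω)) ω)

/-- The same rules applied to two paths that agree up to θ yield the same list as long as the last
observation falls before θ. Monotonicity of the rules puts the earlier observations before θ as
well. -/
lemma build_eq_of_le {f : ℕ → Obs → ℝ≥0∞} (hf : ∀ k e, lastTime k e ≤ f k e) {Y Z : ℝ≥0 → Ω → ℝ}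
    {ω : Ω} {θ : ℝ≥0} (h : ∀ t ≤ θ, Y t ω = Z t ω) (k : ℕ)
    (hk : lastTime k (build f Y k ω) ≤ θ) : build f Y k ω = build f Z k ω := by
  induction k with
  | zero => rfl
  | succ k ih =>
    have h1 : f k (build f Y k ω) ≤ θ := by simpa [lastTime, build] using hk
    have h2 := ih ((hf k _).trans h1)
    have h3 : f k (build f Y k ω) ≠ ∞ := ne_top_of_le_ne_top ENNReal.coe_ne_top h1
    have h4 : observed Y (fun ω => f k (build f Y k ω)) ω =
        observed Z (fun ω => f k (build f Z k ω)) ω := by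
      rw [h2] at h1 h3
      simp only [observed, h2, h3, if_false]
      refine h _ ?_
      rwa [← ENNReal.coe_le_coe, ENNReal.coe_toNNReal h3]
    simp only [build]
    rw [h4, h2]

lemma measurable_build {f : ℕ → Obs → ℝ≥0∞} (hf : ∀ k, Measurable (f k)) {Y : ℝ≥0 → Ω → ℝ}
    {m : MeasurableSpace Ω} (hY : ∀ t, Measurable (Y t)) (hc : ∀ ω, Continuous fun t => Y t ω)
    (k : ℕ) : Measurable (build f Y k) := by
  induction k with
  | zero => exact measurable_const
  | succ k ih =>
    have hT : Measurable fun ω => f k (build f Y k ω) := (hf k).comp ih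
    have hu : Measurable (Function.uncurry Y) :=
      measurable_uncurry_of_continuous_of_measurable hc hY
    have hobs : Measurable (observed Y fun ω => f k (build f Y k ω)) :=
      Measurable.ite (hT (measurableSet_singleton _)) measurable_const
        (hu.comp (hT.ennreal_toNNReal.prodMk measurable_id))
    refine measurable_pi_lambda _ fun i => ?_
    by_cases hi : i = k
    · subst hi
      simpa [build] using hT.prodMk hobs
    · simp only [build, Function.update_of_ne hi]
      exact (measurable_pi_apply i).comp ih

lemma ObsSeq.hist_eq_build {X : ℝ≥0 → Ω → ℝ} (s : ObsSeq X) {f : ℕ → Obs → ℝ≥0∞}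
    (hf : ∀ (k : ℕ) ω, f k (hist X s.time k ω) = s.time (k + 1) ω) (k : ℕ) :
    hist X s.time k = build f X k := by
  induction k with
  | zero => funext ω i; simp [hist, build]
  | succ k ih =>
    funext ω i
    have h1 : (fun ω => f k (build f X k ω)) = s.time (k + 1) := by
      rw [← ih]; funext ω; exact hf k ω
    have h2 : build f X (k + 1) ω = Function.update (hist X s.time k ω) k
        (s.time (k + 1) ω, observed X (s.time (k + 1)) ω) := by
      rw [build, h1, ← ih, hf]
    rw [h2]
    rcases lt_trichotomy i k with h | rfl | h
    · have h' : (i : ℕ∞) < k := by exact_mod_cast h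
      have h'' : (i : ℕ∞) < (k + 1 : ℕ) := by exact_mod_cast h.trans k.lt_succ_self
      simp only [Function.update_of_ne h.ne, hist, h', h'', if_true]
    · have h'' : (i : ℕ∞) < (i + 1 : ℕ) := by exact_mod_cast i.lt_succ_self
      simp only [Function.update_self, hist, h'', if_true]
    · have h' : ¬ (i : ℕ∞) < k := by exact_mod_cast h.le.not_gt
      have h'' : ¬ (i : ℕ∞) < (k + 1 : ℕ) := by exact_mod_cast (Nat.succ_le_of_lt h).not_gt
      simp only [Function.update_of_ne h.ne', hist, h', h'', if_false]

/-- Each time factors through the previous observations by the Doob-Dynkin lemma. The maximum with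
the last time enforces monotonicity also on lists that never occur, in particular on those produced
by running the rules on W. -/
lemma ObsSeq.exists_feedback {X : ℝ≥0 → Ω → ℝ} (s : ObsSeq X) :
    ∃ f : ℕ → Obs → ℝ≥0∞, (∀ k, Measurable (f k)) ∧ (∀ k e, lastTime k e ≤ f k e) ∧
      ∀ (k : ℕ) ω, f k (hist X s.time k ω) = s.time (k + 1) ω := by
  choose f hf hfs using fun k : ℕ => (s.measurable_time_succ k).exists_eq_measurable_comp
  refine ⟨fun k e => max (f k e) (lastTime k e),
    fun k => (hf k).max (measurable_lastTime k), fun k e => le_max_right _ _, fun k ω => ?_⟩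
  have h := congrFun (hfs k) ω
  simp only [Function.comp_apply] at h
  beta_reduce
  rw [← h, s.lastTime_hist, max_eq_left]
  exact s.monotone_time ω k.le_succ

end Build

/-! ### Memorylessness of the disorder time given the observations -/

section Memoryless

variable {Ω : Type*} [MeasurableSpace Ω] {P : Measure Ω} {p lam α : ℝ}
  (M : DisorderModel P p lam)

lemma DisorderModel.measure_lt_Θ (r : ℝ≥0∞) :
    P {ω | r < M.Θ ω} = ENNReal.ofReal ((1 - p) * discount lam r) := by
  induction r with
  | top => simp [discount]
  | coe r => simpa [discount] using M.law_tail r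

variable [IsProbabilityMeasure P]

lemma DisorderModel.lintegral_indep {g : Ω → Obs}
    (hg : Measurable[MeasurableSpace.comap (fun ω t => M.W t ω) inferInstance] g)
    {C H : Obs → ℝ≥0∞} (hC : Measurable C) (hH : Measurable H) :
    ∫⁻ ω, {ω | H (g ω) < M.Θ ω}.indicator (fun ω => C (g ω)) ω ∂P =
      ∫⁻ ω, C (g ω) * ENNReal.ofReal ((1 - p) * discount lam (H (g ω))) ∂P := by
  obtain ⟨γ, hγ, rfl⟩ := hg.exists_eq_measurable_comp
  have hW : Measurable fun ω t => M.W t ω := measurable_pi_lambda _ M.measurable_W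
  set g := γ ∘ fun ω t => M.W t ω with hgdef
  have hgm : Measurable g := hγ.comp hW
  have hind : IndepFun g M.Θ P := (M.indep.symm.comp hγ measurable_id)
  rw [indepFun_iff_map_prod_eq_prod_map_map hgm.aemeasurable M.measurable_Θ.aemeasurable] at hind
  have hset : MeasurableSet {z : Obs × ℝ≥0 | H z.1 < z.2} :=
    measurableSet_lt (hH.comp measurable_fst) (measurable_snd.coe_nnreal_ennreal)
  have hφ : Measurable ({z : Obs × ℝ≥0 | H z.1 < z.2}.indicator fun z => C z.1) :=
    (hC.comp measurable_fst).indicator hset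
  have h1 : ∫⁻ ω, {ω | H (g ω) < M.Θ ω}.indicator (fun ω => C (g ω)) ω ∂P =
      ∫⁻ z, {z : Obs × ℝ≥0 | H z.1 < z.2}.indicator (fun z => C z.1) z
        ∂(P.map fun ω => (g ω, M.Θ ω)) := by
    rw [lintegral_map hφ (hgm.prodMk M.measurable_Θ)]
    rfl
  have : IsProbabilityMeasure (P.map M.Θ) :=
    Measure.isProbabilityMeasure_map M.measurable_Θ.aemeasurable
  rw [h1, hind, lintegral_prod _ hφ.aemeasurable, lintegral_map hφ.lintegral_prod_right' hgm]
  refine lintegral_congr fun ω => ?_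
  have h2 : ∀ θ : ℝ≥0, {z : Obs × ℝ≥0 | H z.1 < z.2}.indicator (fun z => C z.1) (g ω, θ) =
      {θ : ℝ≥0 | H (g ω) < θ}.indicator (fun _ => C (g ω)) θ := fun θ => rfl
  have hs : MeasurableSet {θ : ℝ≥0 | H (g ω) < θ} :=
    measurableSet_lt measurable_const measurable_coe_nnreal_ennreal
  simp only [h2]
  rw [lintegral_indicator_const hs, Measure.map_apply M.measurable_Θ hs, ← M.measure_lt_Θ]
  rfl

/-- Given the first `k` observations and `τ_k < Θ`, the delay `Θ - τ_k` is exponentially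
distributed. -/
lemma ObsSeq.lintegral_memoryless (s : ObsSeq (M.X α)) (k : ℕ) {C H : Obs → ℝ≥0∞}
    (hC : Measurable C) (hH : Measurable H) (hle : ∀ e, lastTime k e ≤ H e) :
    ∫⁻ ω, {ω | H (hist (M.X α) s.time k ω) < M.Θ ω}.indicator
        (fun ω => C (hist (M.X α) s.time k ω)) ω ∂P =
      ∫⁻ ω, {ω | s.time k ω < M.Θ ω}.indicator
        (fun ω => C (hist (M.X α) s.time k ω) *
          ENNReal.ofReal (discount lam (H (hist (M.X α) s.time k ω) - s.time k ω))) ω ∂P := by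
  obtain ⟨f, hf, hfl, hfs⟩ := s.exists_feedback
  have hmW : ∀ t, Measurable[MeasurableSpace.comap (fun ω t => M.W t ω) inferInstance] (M.W t) :=
    fun t => (measurable_pi_apply t).comp (comap_measurable fun ω t => M.W t ω)
  have hg := measurable_build hf hmW M.continuous_W k
  -- The drift vanishes up to Θ, so X may be replaced by W on the event considered; the list built
  -- from W is independent of Θ.
  have hXW : ∀ ω, ∀ t ≤ M.Θ ω, M.X α t ω = M.W t ω := by
    intro ω t ht
    have : (t : ℝ) - M.Θ ω ≤ 0 := sub_nonpos.2 (by exact_mod_cast ht)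
    simp [DisorderModel.X, max_eq_right this]
  -- Both events, for X and for W, place the k-th observation before Θ, so each forces the two lists
  -- to coincide.
  have hpath : ∀ {C H : Obs → ℝ≥0∞}, (∀ e, lastTime k e ≤ H e) → ∀ ω,
      {ω | H (hist (M.X α) s.time k ω) < M.Θ ω}.indicator
        (fun ω => C (hist (M.X α) s.time k ω)) ω =
      {ω | H (build f M.W k ω) < M.Θ ω}.indicator (fun ω => C (build f M.W k ω)) ω := by
    intro C H hle ω
    rw [s.hist_eq_build hfs]
    by_cases h1 : H (build f (M.X α) k ω) < M.Θ ω
    · have := build_eq_of_le hfl (hXW ω) k ((hle _).trans h1.le)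
      simp only [indicator, mem_ofPred_eq, this]
    · have h2 : ¬ H (build f M.W k ω) < M.Θ ω := by
        intro h2
        have := build_eq_of_le hfl (fun t ht => (hXW ω t ht).symm) k ((hle _).trans h2.le)
        exact h1 (this ▸ h2)
      simp [indicator, h1, h2]
  have hC' : Measurable fun e => C e * ENNReal.ofReal (discount lam (H e - lastTime k e)) :=
    hC.mul ((measurable_discount lam).comp (hH.sub (measurable_lastTime k))).ennreal_ofReal
  have key := lintegral_congr (μ := P)
    (hpath (C := fun e => C e * ENNReal.ofReal (discount lam (H e - lastTime k e)))
      (H := lastTime k) fun _ => le_rfl)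
  simp only [s.lastTime_hist] at key
  rw [lintegral_congr (hpath hle), key, M.lintegral_indep hg hC hH,
    M.lintegral_indep hg hC' (measurable_lastTime k)]
  -- Both sides are now integrals over the list built from W. They agree because the discount up to
  -- H is the discount up to τ_k times that from τ_k to H.
  refine lintegral_congr fun ω => ?_
  rw [mul_assoc, ← ENNReal.ofReal_mul (discount_nonneg _ _), mul_left_comm,
    discount_sub_mul lam (hle _)]

end Memoryless

/-! ### Conditional law of Θ between two observations -/

section Stage

lemma one_sub_noObsPosterior (lam q t : ℝ) :
    1 - noObsPosterior lam q t = (1 - q) * Real.exp (-lam * t) := by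
  simp [noObsPosterior]

lemma continuous_noObsPosterior (lam q : ℝ) : Continuous (noObsPosterior lam q) := by
  unfold noObsPosterior; fun_prop

lemma noObsPosterior_nonneg {lam q t : ℝ} (hlam : 0 ≤ lam) (hq₀ : 0 ≤ q)
    (ht : 0 ≤ t) : 0 ≤ noObsPosterior lam q t := by
  have h1 : Real.exp (-lam * t) ≤ 1 := by
    rw [Real.exp_le_one_iff, neg_mul, neg_nonpos]; positivity
  have h2 := Real.exp_pos (-lam * t)
  unfold noObsPosterior
  nlinarith

lemma integral_noObsPosterior {lam : ℝ} (hlam : lam ≠ 0) (q t : ℝ) :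
    ∫ u in (0 : ℝ)..t, noObsPosterior lam q u =
      t - (1 - q) * (1 - Real.exp (-lam * t)) / lam := by
  have h : ∀ x ∈ uIcc 0 t, HasDerivAt (fun u => u + (1 - q) * Real.exp (-lam * u) / lam)
      (noObsPosterior lam q x) x := by
    intro x _
    have h1 : HasDerivAt (fun u => Real.exp (-lam * u)) (Real.exp (-lam * x) * (-lam * 1)) x :=
      ((hasDerivAt_id x).const_mul (-lam)).exp
    have h2 : HasDerivAt (fun u => u + (1 - q) * Real.exp (-lam * u) / lam) _ x :=
      (hasDerivAt_id x).add ((h1.const_mul (1 - q)).div_const lam)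
    refine h2.congr_deriv ?_
    unfold noObsPosterior
    field_simp
    ring
  rw [intervalIntegral.integral_eq_sub_of_hasDerivAt h
    ((continuous_noObsPosterior lam q).intervalIntegrable _ _)]
  simp
  ring

lemma lintegral_noObsPosterior {lam q t : ℝ} (hlam : 0 ≤ lam) (hq₀ : 0 ≤ q)
    (ht : 0 ≤ t) : ∫⁻ u in Ico 0 t, ENNReal.ofReal (noObsPosterior lam q u) =
      ENNReal.ofReal (∫ u in (0 : ℝ)..t, noObsPosterior lam q u) := by
  rw [intervalIntegral.integral_of_le ht, ofReal_integral_eq_lintegral_ofReal, restrict_Ico_eq_restrict_Ioc]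
  · exact ((continuous_noObsPosterior lam q).integrableOn_Icc).mono_set Ioc_subset_Icc_self
  · filter_upwards [ae_restrict_mem measurableSet_Ioc] with u hu
    exact noObsPosterior_nonneg hlam hq₀ hu.1.le

/-- Writing the post-disorder time in [a, b] as an integral of indicators allows Fubini to reduce
expected delays to probabilities of {Θ ≤ a + r}. -/
lemma tsub_max_eq_lintegral {a b : ℝ≥0∞} (ha : a ≠ ∞) (hb : b ≠ ∞) (θ : ℝ≥0) :
    b - max a θ = ∫⁻ r in Ici (0 : ℝ),
      {r : ℝ | a + ENNReal.ofReal r < b ∧ (θ : ℝ≥0∞) ≤ a + ENNReal.ofReal r}.indicator 1 r := by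
  lift a to ℝ≥0 using ha
  lift b to ℝ≥0 using hb
  have hm : MeasurableSet
      {r : ℝ | a + ENNReal.ofReal r < b ∧ (θ : ℝ≥0∞) ≤ a + ENNReal.ofReal r} := by
    have h : Measurable fun r : ℝ => (a : ℝ≥0∞) + ENNReal.ofReal r := by fun_prop
    exact (measurableSet_lt h measurable_const).inter (measurableSet_le measurable_const h)
  rw [lintegral_indicator_one hm, Measure.restrict_apply hm]
  have hset : {r : ℝ | a + ENNReal.ofReal r < b ∧ (θ : ℝ≥0∞) ≤ a + ENNReal.ofReal r} ∩ Ici 0 =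
      Ico (max 0 ((θ : ℝ) - a)) (b - a) := by
    ext r
    simp only [mem_inter_iff, mem_ofPred_eq, mem_Ici, mem_Ico, max_le_iff]
    have key : 0 ≤ r → (((a : ℝ≥0∞) + ENNReal.ofReal r < b ↔ r < b - a) ∧
        ((θ : ℝ≥0∞) ≤ a + ENNReal.ofReal r ↔ (θ : ℝ) - a ≤ r)) := by
      intro hr
      lift r to ℝ≥0 using hr
      rw [ENNReal.ofReal_coe_nnreal, ← ENNReal.coe_add, ENNReal.coe_lt_coe, ENNReal.coe_le_coe,
        ← NNReal.coe_lt_coe, ← NNReal.coe_le_coe, NNReal.coe_add, lt_sub_iff_add_lt',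
        sub_le_iff_le_add']
      exact ⟨Iff.rfl, Iff.rfl⟩
    constructor
    · rintro ⟨⟨h1, h2⟩, hr⟩
      exact ⟨⟨hr, (key hr).2.1 h2⟩, (key hr).1.1 h1⟩
    · rintro ⟨⟨hr, h2⟩, h1⟩
      exact ⟨⟨(key hr).1.2 h1, (key hr).2.2 h2⟩, hr⟩
  rw [hset, Real.volume_Ico]
  have : (b : ℝ) - a - max 0 ((θ : ℝ) - a) = b - (max a θ : ℝ≥0) := by
    rw [NNReal.coe_max]
    rcases le_total (a : ℝ) θ with h | h
    · rw [max_eq_right h, max_eq_right (sub_nonneg.2 h)]; ring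
    · rw [max_eq_left h, max_eq_left (sub_nonpos.2 h)]; ring
  rw [this, ENNReal.ofReal_sub _ (NNReal.coe_nonneg _), ENNReal.ofReal_coe_nnreal,
    ENNReal.ofReal_coe_nnreal, ENNReal.coe_max]

variable {Ω : Type*} [MeasurableSpace Ω] {P : Measure Ω} [IsProbabilityMeasure P] {p lam α : ℝ}
  (M : DisorderModel P p lam) (s : ObsSeq (M.X α))

/-- The a posteriori probability at the time of the `k`-th observation. -/
def obsPosterior (k : ℕ) (ω : Ω) : ℝ := posteriorAt M s k (s.time k ω).toNNReal ω

lemma obsPosterior_nonneg (k : ℕ) (ω : Ω) : 0 ≤ obsPosterior M s k ω :=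
  posteriorAt_nonneg _ _ _ _ _

lemma obsPosterior_le_one (k : ℕ) (ω : Ω) : obsPosterior M s k ω ≤ 1 :=
  posteriorAt_le_one _ _ _ _ _

lemma posterior_time {k : ℕ} {ω : Ω} (h : s.time k ω ≠ ∞) :
    posterior M s (s.time k ω).toNNReal ω = obsPosterior M s k ω := by
  rw [posterior, ENNReal.coe_toNNReal h, s.count_time h, obsPosterior]

lemma measurable_obsPosterior (k : ℕ) : Measurable[s.histσ k] (obsPosterior M s k) := by
  have hD : MeasurableSet {z : Obs × ℝ≥0 | z.2 ≤ (lastTime k z.1).toNNReal} :=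
    measurableSet_le measurable_snd
      (((measurable_lastTime k).comp measurable_fst).ennreal_toNNReal)
  have h := (Kernel.measurable_kernel_prodMk_left
    (κ := condDistrib M.Θ (hist (M.X α) s.time k) P) hD).ennreal_toReal
  have : obsPosterior M s k = (fun e => (condDistrib M.Θ (hist (M.X α) s.time k) P e
      (Prod.mk e ⁻¹' {z : Obs × ℝ≥0 | z.2 ≤ (lastTime k z.1).toNNReal})).toReal) ∘
        hist (M.X α) s.time k := by
    funext ω
    simp only [obsPosterior, posteriorAt, Function.comp_apply, preimage, mem_ofPred_eq,
      s.lastTime_hist]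
    rfl
  rw [this]
  exact h.comp (comap_measurable _)

variable {M s}

/-- Memorylessness reduces the event {H < Θ} to {τ_k < Θ} at the price of a discount factor;
disintegration of Θ along the first k observations then turns the latter event into 1 - Π_{τ_k}. -/
lemma measure_inter_lt_Θ {k : ℕ} {A : Set Ω} (hA : MeasurableSet[s.histσ k] A)
    (hfin : ∀ ω ∈ A, s.time k ω ≠ ∞) {H : Ω → ℝ≥0∞} (hH : Measurable[s.histσ k] H)
    (hle : ∀ ω ∈ A, s.time k ω ≤ H ω) :
    P (A ∩ {ω | H ω < M.Θ ω}) =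
      ∫⁻ ω in A, ENNReal.ofReal ((1 - obsPosterior M s k ω) *
        discount lam (H ω - s.time k ω)) ∂P := by
  obtain ⟨B, hB, rfl⟩ := hA
  obtain ⟨η, hη, rfl⟩ := hH.exists_eq_measurable_comp
  set h := hist (M.X α) s.time k with hdef
  have hh : Measurable h := s.measurable_hist M k
  have hlt : ∀ ω, lastTime k (h ω) = s.time k ω := s.lastTime_hist k
  -- Memorylessness is stated for rules that dominate the last time on every list. The bound is
  -- known only on A, and the maximum changes nothing there.
  have hη' : Measurable fun e => max (η e) (lastTime k e) := hη.max (measurable_lastTime k)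
  have hC : Measurable (B.indicator (1 : Obs → ℝ≥0∞)) := measurable_one.indicator hB
  have hmem : MeasurableSet (h ⁻¹' B ∩ {ω | (η ∘ h) ω < M.Θ ω}) :=
    (hh hB).inter (measurableSet_lt (hη.comp hh) M.measurable_Θ.coe_nnreal_ennreal)
  have h1 : P (h ⁻¹' B ∩ {ω | (η ∘ h) ω < M.Θ ω}) =
      ∫⁻ ω, {ω | max (η (h ω)) (lastTime k (h ω)) < M.Θ ω}.indicator
        (fun ω => B.indicator (1 : Obs → ℝ≥0∞) (h ω)) ω ∂P := by
    rw [← lintegral_indicator_one hmem]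
    refine lintegral_congr fun ω => ?_
    by_cases hω : h ω ∈ B
    · have := hle ω hω
      simp only [Function.comp_apply] at this
      simp only [indicator, mem_inter_iff, mem_preimage, hω, true_and, hlt, max_eq_left this,
        mem_ofPred_eq, Function.comp_apply, if_true, Pi.one_apply]
    · simp [indicator, hω]
  set D := fun e => B.indicator (1 : Obs → ℝ≥0∞) e *
    ENNReal.ofReal (discount lam (max (η e) (lastTime k e) - lastTime k e)) with hD
  have hDm : Measurable D :=
    hC.mul ((measurable_discount lam).comp (hη'.sub (measurable_lastTime k))).ennreal_ofReal
  have hset : MeasurableSet {z : Obs × ℝ≥0 | lastTime k z.1 < z.2} :=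
    measurableSet_lt ((measurable_lastTime k).comp measurable_fst)
      (measurable_snd.coe_nnreal_ennreal)
  have h2 := lintegral_hist_theta M s k (φ := {z : Obs × ℝ≥0 | lastTime k z.1 < z.2}.indicator
    fun z => D z.1) ((hDm.comp measurable_fst).indicator hset)
  rw [h1, s.lintegral_memoryless M k hC hη' fun e => le_max_right _ _,
    ← lintegral_indicator (hh hB)]
  have h3 : ∀ ω, {ω | s.time k ω < M.Θ ω}.indicator (fun ω => B.indicator 1 (h ω) *
      ENNReal.ofReal (discount lam (max (η (h ω)) (lastTime k (h ω)) - s.time k ω))) ω =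
      {z : Obs × ℝ≥0 | lastTime k z.1 < z.2}.indicator (fun z => D z.1) (h ω, M.Θ ω) := by
    intro ω
    simp only [indicator, mem_ofPred_eq, hD, hlt]
  rw [lintegral_congr h3, h2]
  refine lintegral_congr fun ω => ?_
  have h4 : ∀ θ : ℝ≥0, {z : Obs × ℝ≥0 | lastTime k z.1 < z.2}.indicator (fun z => D z.1) (h ω, θ) =
      {θ : ℝ≥0 | s.time k ω < θ}.indicator (fun _ => D (h ω)) θ := by
    intro θ; simp only [indicator, mem_ofPred_eq, hlt]
  have hs : MeasurableSet {θ : ℝ≥0 | s.time k ω < θ} :=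
    measurableSet_lt measurable_const measurable_coe_nnreal_ennreal
  simp only [← hdef, h4]
  rw [lintegral_indicator_const hs]
  by_cases hω : h ω ∈ B
  · have hf := hfin ω hω
    have := hle ω hω
    simp only [Function.comp_apply] at this
    have h5 : condDistrib M.Θ h P (h ω) {θ : ℝ≥0 | s.time k ω < θ} =
        ENNReal.ofReal (1 - obsPosterior M s k ω) := by
      have h6 : {θ : ℝ≥0 | s.time k ω < θ} = (Iic (s.time k ω).toNNReal)ᶜ := by
        ext θ
        simp only [mem_ofPred_eq, mem_compl_iff, mem_Iic, not_le]
        rw [← ENNReal.coe_lt_coe, ENNReal.coe_toNNReal hf]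
      rw [h6, ← ofReal_measureReal, measureReal_compl measurableSet_Iic]
      simp [obsPosterior, posteriorAt, hdef]
    rw [h5, indicator_of_mem (show ω ∈ h ⁻¹' B from hω),
      ENNReal.ofReal_mul (sub_nonneg.2 (obsPosterior_le_one M s k ω)), mul_comm]
    simp [hD, hω, hlt, max_eq_left this]
  · simp [hD, hω]

lemma measure_inter_Θ_le (hlam : 0 ≤ lam) {k : ℕ} {A : Set Ω} (hA : MeasurableSet[s.histσ k] A)
    (hfin : ∀ ω ∈ A, s.time k ω ≠ ∞) {H : Ω → ℝ≥0∞} (hH : Measurable[s.histσ k] H)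
    (hle : ∀ ω ∈ A, s.time k ω ≤ H ω) :
    P (A ∩ {ω | M.Θ ω ≤ H ω}) =
      ∫⁻ ω in A, ENNReal.ofReal (1 - (1 - obsPosterior M s k ω) *
        discount lam (H ω - s.time k ω)) ∂P := by
  have h1 := measure_inter_lt_Θ hA hfin hH hle
  have hm : MeasurableSet {ω | H ω < M.Θ ω} :=
    measurableSet_lt (hH.mono (s.histσ_le M k) le_rfl) M.measurable_Θ.coe_nnreal_ennreal
  have h2 : P (A ∩ {ω | M.Θ ω ≤ H ω}) + P (A ∩ {ω | H ω < M.Θ ω}) = P A := by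
    rw [add_comm, ← measure_inter_add_sdiff A hm]
    congr 2
    ext ω; simp [not_lt]
  have hmeas : Measurable fun ω => ENNReal.ofReal ((1 - obsPosterior M s k ω) *
        discount lam (H ω - s.time k ω)) := by
    have a1 := (measurable_obsPosterior M s k).mono (s.histσ_le M k) le_rfl
    have a2 := (measurable_discount lam).comp
      ((hH.mono (s.histσ_le M k) le_rfl).sub (s.measurable_time M k))
    exact ((measurable_const.sub a1).mul a2).ennreal_ofReal
  have h3 : ∫⁻ ω in A, ENNReal.ofReal (1 - (1 - obsPosterior M s k ω) *
        discount lam (H ω - s.time k ω)) ∂P + P (A ∩ {ω | H ω < M.Θ ω}) = P A := by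
    rw [h1, ← lintegral_add_right _ hmeas]
    have : ∀ ω, ENNReal.ofReal (1 - (1 - obsPosterior M s k ω) *
        discount lam (H ω - s.time k ω)) + ENNReal.ofReal ((1 - obsPosterior M s k ω) *
        discount lam (H ω - s.time k ω)) = 1 := by
      intro ω
      have b1 := obsPosterior_nonneg M s k ω
      have b2 := obsPosterior_le_one M s k ω
      have b3 := discount_nonneg lam (H ω - s.time k ω)
      have b4 := discount_le_one hlam (H ω - s.time k ω)
      rw [← ENNReal.ofReal_add (by nlinarith) (mul_nonneg (by linarith) b3)]
      simp
    simp [this]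
  exact (ENNReal.add_left_inj (measure_ne_top P _)).1 (h2.trans h3.symm)

/-- After exchanging the integrals over r and ω, `measure_inter_Θ_le` at the time τ_k + r gives the
no-observation posterior at r. -/
lemma setLIntegral_tsub_max (hlam : 0 < lam) {k : ℕ} {A : Set Ω}
    (hA : MeasurableSet[s.histσ k] A) (hfin : ∀ ω ∈ A, s.time k ω ≠ ∞) {H : Ω → ℝ≥0∞}
    (hH : Measurable[s.histσ k] H) (hHf : ∀ ω ∈ A, H ω ≠ ∞) :
    ∫⁻ ω in A, (H ω - max (s.time k ω) (M.Θ ω)) ∂P =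
      ∫⁻ ω in A, ENNReal.ofReal (∫ u in (0 : ℝ)..(H ω - s.time k ω).toReal,
        noObsPosterior lam (obsPosterior M s k ω) u) ∂P := by
  have hA' := s.histσ_le M k _ hA
  have hH' := hH.mono (s.histσ_le M k) le_rfl
  have hT := s.measurable_time M k
  have hT' : Measurable[s.histσ k] (s.time k) := s.measurable_time_of_le (by exact_mod_cast k.le_succ)
  have hπ := (measurable_obsPosterior M s k).mono (s.histσ_le M k) le_rfl
  have hu : Measurable fun z : Ω × ℝ => s.time k z.1 + ENNReal.ofReal z.2 :=
    (hT.comp measurable_fst).add measurable_snd.ennreal_ofReal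
  have hset : MeasurableSet {z : Ω × ℝ | s.time k z.1 + ENNReal.ofReal z.2 < H z.1} :=
    measurableSet_lt hu (hH'.comp measurable_fst)
  have hset2 : MeasurableSet {z : Ω × ℝ | (M.Θ z.1 : ℝ≥0∞) ≤ s.time k z.1 + ENNReal.ofReal z.2} :=
    measurableSet_le (M.measurable_Θ.comp measurable_fst).coe_nnreal_ennreal hu
  have hL : ∫⁻ ω in A, (H ω - max (s.time k ω) (M.Θ ω)) ∂P =
      ∫⁻ ω in A, (∫⁻ r in Ici (0 : ℝ), ({z : Ω × ℝ | s.time k z.1 + ENNReal.ofReal z.2 < H z.1} ∩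
        {z : Ω × ℝ | (M.Θ z.1 : ℝ≥0∞) ≤ s.time k z.1 + ENNReal.ofReal z.2}).indicator 1 (ω, r)) ∂P := by
    refine setLIntegral_congr_fun hA' fun ω hω => ?_
    exact tsub_max_eq_lintegral (hfin ω hω) (hHf ω hω) (M.Θ ω)
  have hR : ∫⁻ ω in A, ENNReal.ofReal (∫ u in (0 : ℝ)..(H ω - s.time k ω).toReal,
        noObsPosterior lam (obsPosterior M s k ω) u) ∂P =
      ∫⁻ ω in A, (∫⁻ r in Ici (0 : ℝ), {z : Ω × ℝ | s.time k z.1 + ENNReal.ofReal z.2 < H z.1}.indicator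
        (fun z => ENNReal.ofReal (noObsPosterior lam (obsPosterior M s k z.1) z.2)) (ω, r)) ∂P := by
    refine setLIntegral_congr_fun hA' fun ω hω => ?_
    rw [← lintegral_noObsPosterior hlam.le (obsPosterior_nonneg M s k ω)
      ENNReal.toReal_nonneg]
    have hs : MeasurableSet {r : ℝ | s.time k ω + ENNReal.ofReal r < H ω} :=
      measurable_prodMk_left hset
    have h1 : ∀ r : ℝ, {z : Ω × ℝ | s.time k z.1 + ENNReal.ofReal z.2 < H z.1}.indicator
        (fun z => ENNReal.ofReal (noObsPosterior lam (obsPosterior M s k z.1) z.2)) (ω, r) =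
        {r : ℝ | s.time k ω + ENNReal.ofReal r < H ω}.indicator
          (fun r => ENNReal.ofReal (noObsPosterior lam (obsPosterior M s k ω) r)) r :=
      fun r => rfl
    simp only [h1]
    rw [lintegral_indicator hs, Measure.restrict_restrict hs]
    congr 2
    ext r
    simp only [mem_Ico, mem_inter_iff, mem_ofPred_eq, mem_Ici]
    rw [and_comm]
    refine and_congr_left fun hr => ?_
    rw [← ENNReal.ofReal_lt_iff_lt_toReal hr (ENNReal.sub_ne_top (hHf ω hω)),
      lt_tsub_iff_left]
  have hm1 : AEMeasurable (Function.uncurry fun (ω : Ω) (r : ℝ) =>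
      ({z : Ω × ℝ | s.time k z.1 + ENNReal.ofReal z.2 < H z.1} ∩
        {z : Ω × ℝ | (M.Θ z.1 : ℝ≥0∞) ≤ s.time k z.1 + ENNReal.ofReal z.2}).indicator
          (1 : Ω × ℝ → ℝ≥0∞) (ω, r)) ((P.restrict A).prod (volume.restrict (Ici 0))) :=
    (measurable_one.indicator (hset.inter hset2)).aemeasurable
  have hm2 : AEMeasurable (Function.uncurry fun (ω : Ω) (r : ℝ) =>
      {z : Ω × ℝ | s.time k z.1 + ENNReal.ofReal z.2 < H z.1}.indicator
        (fun z => ENNReal.ofReal (noObsPosterior lam (obsPosterior M s k z.1) z.2)) (ω, r))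
      ((P.restrict A).prod (volume.restrict (Ici 0))) := by
    have h : Measurable fun z : Ω × ℝ =>
        ENNReal.ofReal (noObsPosterior lam (obsPosterior M s k z.1) z.2) := by
      unfold noObsPosterior
      have : Measurable ((obsPosterior M s k) ∘ (Prod.fst : Ω × ℝ → Ω)) := hπ.comp measurable_fst
      simp only [Function.comp_def] at this
      fun_prop
    exact (h.indicator hset).aemeasurable
  rw [hL, hR, lintegral_lintegral_swap hm1, lintegral_lintegral_swap hm2]
  refine setLIntegral_congr_fun measurableSet_Ici fun r hr => ?_
  have hHr : Measurable[s.histσ k] fun ω => s.time k ω + ENNReal.ofReal r :=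
    hT'.add measurable_const
  have hB : MeasurableSet[s.histσ k] {ω | s.time k ω + ENNReal.ofReal r < H ω} :=
    let _ := s.histσ k
    measurableSet_lt hHr hH
  have hB' := s.histσ_le M k _ hB
  have hC : MeasurableSet {ω | (M.Θ ω : ℝ≥0∞) ≤ s.time k ω + ENNReal.ofReal r} :=
    measurable_prodMk_right hset2
  have key := measure_inter_Θ_le (M := M) (s := s) hlam.le (hA.inter hB) (fun ω hω => hfin ω hω.1) hHr
    (fun ω _ => le_self_add)
  have h1 : ∀ ω, ({z : Ω × ℝ | s.time k z.1 + ENNReal.ofReal z.2 < H z.1} ∩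
      {z : Ω × ℝ | (M.Θ z.1 : ℝ≥0∞) ≤ s.time k z.1 + ENNReal.ofReal z.2}).indicator
        (1 : Ω × ℝ → ℝ≥0∞) (ω, r) =
      ({ω | s.time k ω + ENNReal.ofReal r < H ω} ∩
        {ω | (M.Θ ω : ℝ≥0∞) ≤ s.time k ω + ENNReal.ofReal r}).indicator 1 ω := fun ω => rfl
  have h2 : ∀ ω, {z : Ω × ℝ | s.time k z.1 + ENNReal.ofReal z.2 < H z.1}.indicator
      (fun z => ENNReal.ofReal (noObsPosterior lam (obsPosterior M s k z.1) z.2)) (ω, r) =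
      {ω | s.time k ω + ENNReal.ofReal r < H ω}.indicator
        (fun ω => ENNReal.ofReal (noObsPosterior lam (obsPosterior M s k ω) r)) ω :=
    fun ω => rfl
  simp only [h1, h2]
  rw [lintegral_indicator_one (hB'.inter hC), Measure.restrict_apply (hB'.inter hC),
    lintegral_indicator hB', Measure.restrict_restrict hB', inter_comm _ A, ← inter_assoc, key,
    inter_comm _ A]
  refine setLIntegral_congr_fun (hA'.inter hB') fun ω hω => ?_
  rw [ENNReal.add_sub_cancel_left (hfin ω hω.1)]
  simp [noObsPosterior, discount, ENNReal.toReal_ofReal hr]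

end Stage

/-! ### Decomposition of the risk by the number of observations -/

section Risk

/-- The cost of stopping at time `t` when no observation is made, the posterior starting from `q`. -/
def waitCost (lam c q t : ℝ) : ℝ :=
  1 - noObsPosterior lam q t + c * ∫ u in (0 : ℝ)..t, noObsPosterior lam q u

lemma tsub_max_add_tsub {a b : ℝ≥0∞} (h : a ≤ b) (θ : ℝ≥0∞) :
    (b - max a θ) + (a - θ) = b - θ := by
  rcases le_total a θ with h1 | h1
  · rw [max_eq_right h1, tsub_eq_zero_of_le h1, add_zero]
  · rw [max_eq_left h1, tsub_add_tsub_cancel h h1]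

namespace ObsSeq

variable {Ω : Type*} {X : ℝ≥0 → Ω → ℝ} (s : ObsSeq X)

lemma tsum_ite_time_le {u : ℝ≥0∞} {ω : Ω} {m : ℕ} (h : s.count u ω = m) (g : ℕ → ℝ≥0∞) :
    ∑' k, (if s.time (k + 1) ω ≤ u then g k else 0) = ∑ k ∈ Finset.range m, g k := by
  have h1 : ∀ k, s.time (k + 1) ω ≤ u ↔ k < m := fun k => by
    rw [← s.lt_count_iff, h, Nat.cast_lt]
  simp only [h1]
  rw [tsum_eq_sum (s := Finset.range m) fun k hk => by simp_all]
  exact Finset.sum_congr rfl fun k hk => if_pos (Finset.mem_range.1 hk)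

lemma numObs_eq {τ : Ω → ℝ≥0∞} {ω : Ω} {m : ℕ} (h : s.count (τ ω) ω = m) : numObs s τ ω = m := by
  rw [numObs, s.tsum_ite_time_le h]; simp

lemma sum_tsub_max (ω : Ω) (θ : ℝ≥0∞) (m : ℕ) :
    ∑ k ∈ Finset.range m, (s.time (k + 1) ω - max (s.time k ω) θ) = s.time m ω - θ := by
  induction m with
  | zero => simp [s.time_zero]
  | succ m ih => rw [Finset.sum_range_succ, ih, add_comm,
      tsub_max_add_tsub (s.monotone_time ω m.le_succ)]

lemma time_ne_top_of_count_eq {u : ℝ≥0∞} {ω : Ω} {m : ℕ} (h : s.count u ω = m) {k : ℕ}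
    (hk : k ≤ m) : s.time k ω ≠ ∞ := by
  have h1 := s.count_eq_coe_iff.1 h
  exact ne_top_of_le_ne_top (ne_top_of_lt h1.2) ((s.monotone_time ω hk).trans h1.1)

lemma tsum_indicator_count {τ : Ω → ℝ≥0∞} {ω : Ω} {m : ℕ} (h : s.count (τ ω) ω = m)
    (g : ℕ → Ω → ℝ≥0∞) :
    ∑' k : ℕ, {ω | s.count (τ ω) ω = k}.indicator (g k) ω = g m ω := by
  rw [tsum_eq_single m fun k hk => ?_]
  · exact indicator_of_mem (show ω ∈ {ω | s.count (τ ω) ω = m} from h) _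
  · refine indicator_of_notMem (fun h' => hk ?_) _
    have h2 : s.count (τ ω) ω = k := h'
    exact_mod_cast h2.symm.trans h

end ObsSeq

variable {Ω : Type*} [MeasurableSpace Ω] {P : Measure Ω} {p lam α : ℝ}

lemma lintegral_tsum_indicator {A : ℕ → Set Ω} (hA : ∀ k, MeasurableSet (A k)) {g : ℕ → Ω → ℝ≥0∞}
    (hg : ∀ k, Measurable (g k)) :
    ∫⁻ ω, ∑' k, (A k).indicator (g k) ω ∂P = ∑' k, ∫⁻ ω in A k, g k ω ∂P := by
  rw [lintegral_tsum fun k => ((hg k).indicator (hA k)).aemeasurable]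
  exact tsum_congr fun k => lintegral_indicator (hA k) _

variable [IsProbabilityMeasure P] (M : DisorderModel P p lam) (s : ObsSeq (M.X α))

/-- The conditional expected time spent after the disorder between the `k`-th and the next
observation. -/
def stageDelay (k : ℕ) (ω : Ω) : ℝ≥0∞ :=
  ENNReal.ofReal (∫ u in (0 : ℝ)..(s.time (k + 1) ω - s.time k ω).toReal,
    noObsPosterior lam (obsPosterior M s k ω) u)

/-- The conditional expected time spent after the disorder in the periods between two observations
made up to time `τ`. -/
def totalDelay (τ : Ω → ℝ≥0∞) (ω : Ω) : ℝ≥0∞ :=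
  ∑' k, if s.time (k + 1) ω ≤ τ ω then stageDelay M s k ω else 0

variable {M s}

lemma measurable_integral_noObsPosterior (hlam : lam ≠ 0) {q : Ω → ℝ} {H : Ω → ℝ≥0∞}
    (hq : Measurable q) (hH : Measurable H) :
    Measurable fun ω => ∫ u in (0 : ℝ)..(H ω).toReal, noObsPosterior lam (q ω) u := by
  simp only [integral_noObsPosterior hlam]
  have := hH.ennreal_toReal
  fun_prop

lemma measurable_waitCost (hlam : lam ≠ 0) (c : ℝ) {q : Ω → ℝ} {H : Ω → ℝ≥0∞}
    (hq : Measurable q) (hH : Measurable H) :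
    Measurable fun ω => waitCost lam c (q ω) (H ω).toReal := by
  have h1 := measurable_integral_noObsPosterior hlam hq hH
  have h2 := hH.ennreal_toReal
  have h3 : Measurable fun ω => noObsPosterior lam (q ω) (H ω).toReal := by
    unfold noObsPosterior; fun_prop
  unfold waitCost
  fun_prop

/-- The Bayes risk, without the cost of the observations, of a time `T` which is determined by the
observations made up to the stopping time `τ`. -/
lemma measure_lt_add_lintegral_delay (hlam : 0 < lam) {c : ℝ} (hc : 0 ≤ c) {τ : Ω → ℝ≥0∞}
    (hτ : IsObsStopping M s τ) (hN : ∀ᵐ ω ∂P, ∃ m : ℕ, s.count (τ ω) ω = m)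
    {T : Ω → ℝ≥0∞} {H : ℕ → Ω → ℝ≥0∞} (hH : ∀ m : ℕ, Measurable[s.histσ m] (H m))
    (hT : ∀ (m : ℕ) ω, s.count (τ ω) ω = m → T ω = H m ω ∧ s.time m ω ≤ H m ω ∧ H m ω ≠ ∞) :
    P {ω | T ω < M.Θ ω} + ∫⁻ ω, ENNReal.ofReal c * (T ω - M.Θ ω) ∂P =
      ∫⁻ ω, (∑' m : ℕ, {ω | s.count (τ ω) ω = m}.indicator
        (fun ω => ENNReal.ofReal (waitCost lam c (obsPosterior M s m ω)
          (H m ω - s.time m ω).toReal)) ω + ENNReal.ofReal c * totalDelay M s τ ω) ∂P := by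
  set A : ℕ → Set Ω := fun m => {ω | s.count (τ ω) ω = m} with hAdef
  -- Finiteness is added because the conditional delay formula needs a finite right endpoint; when
  -- the count is finite the extra condition holds automatically.
  set B : ℕ → Set Ω := fun k => {ω | s.time (k + 1) ω ≤ τ ω} ∩ {ω | s.time (k + 1) ω ≠ ∞} with hBdef
  have hA : ∀ m : ℕ, MeasurableSet[s.histσ m] (A m) := hτ.measurableSet_count_eq
  have hA' : ∀ m, MeasurableSet (A m) := fun m => s.histσ_le M m _ (hA m)
  have hBt : ∀ k : ℕ, Measurable[s.histσ k] (s.time (k + 1)) := s.measurable_time_succ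
  have hB : ∀ k : ℕ, MeasurableSet[s.histσ k] (B k) := fun k =>
    (hτ.measurableSet_time_le le_rfl).inter (hBt k (measurableSet_singleton ∞).compl)
  have hB' : ∀ k, MeasurableSet (B k) := fun m => s.histσ_le M m _ (hB m)
  have hH' : ∀ m, Measurable (H m) := fun m => (hH m).mono (s.histσ_le M m) le_rfl
  have htime := s.measurable_time M
  have hΘ := M.measurable_Θ.coe_nnreal_ennreal
  have hπ : ∀ k, Measurable (obsPosterior M s k) :=
    fun k => (measurable_obsPosterior M s k).mono (s.histσ_le M k) le_rfl
  have hAfin : ∀ m, ∀ ω ∈ A m, s.time m ω ≠ ∞ := fun m ω hω =>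
    s.time_ne_top_of_count_eq hω le_rfl
  have hBite : ∀ (m : ℕ) ω (g : ℕ → Ω → ℝ≥0∞), s.count (τ ω) ω = m →
      ∑' k, (B k).indicator (g k) ω = ∑' k, if s.time (k + 1) ω ≤ τ ω then g k ω else 0 := by
    intro m ω g hm
    refine tsum_congr fun k => ?_
    by_cases h : s.time (k + 1) ω ≤ τ ω
    · have h1 : k + 1 ≤ m := by
        have := s.lt_count_iff.2 h
        rw [hm] at this
        exact_mod_cast this
      have h2 : ω ∈ B k := ⟨h, s.time_ne_top_of_count_eq hm h1⟩
      rw [indicator_of_mem h2, if_pos h]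
    · have h2 : ω ∉ B k := fun h' => h h'.1
      rw [indicator_of_notMem h2, if_neg h]
  -- the probability of a false alarm
  have e1 : P {ω | T ω < M.Θ ω} = ∑' m, ∫⁻ ω in A m,
      ENNReal.ofReal ((1 - obsPosterior M s m ω) * discount lam (H m ω - s.time m ω)) ∂P := by
    have h1 : {ω | T ω < M.Θ ω} =ᵐ[P] ⋃ m, A m ∩ {ω | H m ω < M.Θ ω} := by
      filter_upwards [hN] with ω hω
      obtain ⟨m, hm⟩ := hω
      refine propext ?_
      change T ω < M.Θ ω ↔ ω ∈ ⋃ m, A m ∩ {ω | H m ω < M.Θ ω}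
      simp only [mem_iUnion, mem_inter_iff, mem_ofPred_eq]
      constructor
      · intro h
        exact ⟨m, hm, (hT m ω hm).1 ▸ h⟩
      · rintro ⟨k, hk, h⟩
        rwa [(hT k ω hk).1]
    rw [measure_congr h1, measure_iUnion]
    · exact tsum_congr fun m =>
        measure_inter_lt_Θ (hA m) (hAfin m) (hH m) fun ω hω => (hT m ω hω).2.1
    · intro i j hij
      refine disjoint_left.2 fun ω hi hj => hij ?_
      have h2 : s.count (τ ω) ω = i := hi.1
      have h3 : s.count (τ ω) ω = j := hj.1
      exact_mod_cast h2.symm.trans h3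
    · exact fun m => (hA' m).inter (measurableSet_lt (hH' m) hΘ)
  -- the expected delay
  have e2 : ∫⁻ ω, (T ω - M.Θ ω) ∂P =
      ∑' m, ∫⁻ ω in A m, ENNReal.ofReal (∫ u in (0 : ℝ)..(H m ω - s.time m ω).toReal,
        noObsPosterior lam (obsPosterior M s m ω) u) ∂P +
      ∑' k, ∫⁻ ω in B k, stageDelay M s k ω ∂P := by
    -- The post-disorder time up to T is the part after the last observation plus the parts in the
    -- completed intervals, which telescope.
    have h1 : ∀ᵐ ω ∂P, T ω - M.Θ ω =
        ∑' m, (A m).indicator (fun ω => H m ω - max (s.time m ω) (M.Θ ω)) ω +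
        ∑' k, (B k).indicator (fun ω => s.time (k + 1) ω - max (s.time k ω) (M.Θ ω)) ω := by
      filter_upwards [hN] with ω hω
      obtain ⟨m, hm⟩ := hω
      obtain ⟨hT1, hT2, hT3⟩ := hT m ω hm
      rw [s.tsum_indicator_count hm fun m ω => H m ω - max (s.time m ω) (M.Θ ω)]
      have h2 : ∑' k, (B k).indicator
          (fun ω => s.time (k + 1) ω - max (s.time k ω) (M.Θ ω)) ω = s.time m ω - M.Θ ω := by
        rw [← s.sum_tsub_max ω (M.Θ ω) m, ← s.tsum_ite_time_le hm,
          hBite m ω (fun k ω => s.time (k + 1) ω - max (s.time k ω) (M.Θ ω)) hm]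
      rw [h2, hT1, tsub_max_add_tsub hT2]
    have hm1 : ∀ m, Measurable fun ω => H m ω - max (s.time m ω) (M.Θ ω) :=
      fun m => (hH' m).sub ((htime m).max hΘ)
    have hm2 : ∀ k, Measurable fun ω => s.time (k + 1) ω - max (s.time k ω) (M.Θ ω) :=
      fun k => (htime _).sub ((htime k).max hΘ)
    rw [lintegral_congr_ae h1, lintegral_add_left
      (Measurable.tsum fun m => (hm1 m).indicator (hA' m)),
      lintegral_tsum_indicator hA' hm1, lintegral_tsum_indicator hB' hm2]
    congr 1
    · exact tsum_congr fun m => setLIntegral_tsub_max hlam (hA m) (hAfin m) (hH m)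
        fun ω hω => (hT m ω hω).2.2
    · exact tsum_congr fun k => setLIntegral_tsub_max hlam (hB k)
        (fun ω hω => ne_top_of_le_ne_top hω.2 (s.monotone_time ω k.le_succ)) (hBt k)
        fun ω hω => hω.2
  have hm1 : ∀ m, Measurable fun ω => ENNReal.ofReal (waitCost lam c (obsPosterior M s m ω)
      (H m ω - s.time m ω).toReal) := fun m =>
    (measurable_waitCost hlam.ne' c (hπ m) ((hH' m).sub (htime m))).ennreal_ofReal
  have hm2 : ∀ m, Measurable fun ω => ENNReal.ofReal (∫ u in (0 : ℝ)..(H m ω - s.time m ω).toReal,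
      noObsPosterior lam (obsPosterior M s m ω) u) := fun m =>
    (measurable_integral_noObsPosterior hlam.ne' (hπ m) ((hH' m).sub (htime m))).ennreal_ofReal
  have hm3 : ∀ m, Measurable (stageDelay M s m) := fun m =>
    (measurable_integral_noObsPosterior hlam.ne' (hπ m) ((htime _).sub (htime m))).ennreal_ofReal
  have e3 : ∫⁻ ω, totalDelay M s τ ω ∂P = ∑' k, ∫⁻ ω in B k, stageDelay M s k ω ∂P := by
    rw [← lintegral_tsum_indicator hB' hm3]
    refine lintegral_congr_ae ?_
    filter_upwards [hN] with ω hω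
    obtain ⟨m, hm⟩ := hω
    exact (hBite m ω (stageDelay M s) hm).symm
  rw [lintegral_const_mul' _ _ ENNReal.ofReal_ne_top, e1, e2, mul_add, ← add_assoc,
    lintegral_add_left (Measurable.tsum fun m => (hm1 m).indicator (hA' m)),
    lintegral_const_mul' _ _ ENNReal.ofReal_ne_top, e3, lintegral_tsum_indicator hA' hm1,
    ← ENNReal.tsum_mul_left, ← ENNReal.tsum_add]
  congr 1
  refine tsum_congr fun m => ?_
  rw [← lintegral_const_mul' _ _ ENNReal.ofReal_ne_top, ← lintegral_add_right _ ((hm2 m).const_mul _)]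
  refine setLIntegral_congr_fun (hA' m) fun ω hω => ?_
  obtain ⟨-, hT2, hT3⟩ := hT m ω hω
  have h1 : discount lam (H m ω - s.time m ω) =
      Real.exp (-lam * (H m ω - s.time m ω).toReal) := if_neg (ENNReal.sub_ne_top hT3)
  have h2 : 0 ≤ ∫ u in (0 : ℝ)..(H m ω - s.time m ω).toReal,
      noObsPosterior lam (obsPosterior M s m ω) u :=
    intervalIntegral.integral_nonneg ENNReal.toReal_nonneg fun u hu =>
      noObsPosterior_nonneg hlam.le (obsPosterior_nonneg M s m ω) hu.1
  rw [h1, ← ENNReal.ofReal_mul hc, ← one_sub_noObsPosterior, ← ENNReal.ofReal_add _ (mul_nonneg hc h2)]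
  · rfl
  · rw [one_sub_noObsPosterior]
    exact mul_nonneg (sub_nonneg.2 (obsPosterior_le_one M s m ω)) (Real.exp_pos _).le

end Risk

/-! ### Optimal waiting without observations -/

section WaitCost

variable {lam c q : ℝ}

lemma waitCost_eq (hlam : lam ≠ 0) (c q t : ℝ) : waitCost lam c q t =
    (1 - q) * Real.exp (-lam * t) + c * (t - (1 - q) * (1 - Real.exp (-lam * t)) / lam) := by
  rw [waitCost, one_sub_noObsPosterior, integral_noObsPosterior hlam]

lemma waitCost_nonneg (hlam : 0 ≤ lam) (hc : 0 ≤ c) (hq₀ : 0 ≤ q) (hq₁ : q ≤ 1) {t : ℝ}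
    (ht : 0 ≤ t) : 0 ≤ waitCost lam c q t := by
  unfold waitCost
  refine add_nonneg ?_ (mul_nonneg hc ?_)
  · rw [one_sub_noObsPosterior]
    exact mul_nonneg (sub_nonneg.2 hq₁) (Real.exp_pos _).le
  · exact intervalIntegral.integral_nonneg ht fun u hu => noObsPosterior_nonneg hlam hq₀ hu.1

/-- The optimal time to wait when no observation is made. -/
def optTime (lam c q : ℝ) : ℝ := max 0 (Real.log ((1 - q) * (lam + c) / c) / lam)

lemma optTime_nonneg (lam c q : ℝ) : 0 ≤ optTime lam c q := le_max_left _ _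

lemma measurable_optTime (lam c : ℝ) : Measurable (optTime lam c) := by
  unfold optTime
  have := Real.measurable_log
  fun_prop

/-- Up to a constant, the cost is c/λ times the convex function y e^{-λr} + λr, stationary where
e^{λr} = y. For y ≤ 1 the minimum on r ≥ 0 is at 0; this includes y = 0, where `Real.log 0 = 0`. -/
lemma waitCost_optTime_le (hlam : 0 < lam) (hc : 0 < c) (hq₁ : q ≤ 1) {t : ℝ} (ht : 0 ≤ t) :
    waitCost lam c q (optTime lam c q) ≤ waitCost lam c q t := by
  set y := (1 - q) * (lam + c) / c with hy
  have hy0 : 0 ≤ y := div_nonneg (mul_nonneg (sub_nonneg.2 hq₁) (by linarith)) hc.le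
  have hform : ∀ r, waitCost lam c q r =
      c / lam * (y * Real.exp (-lam * r) + lam * r) - c * (1 - q) / lam := by
    intro r
    rw [waitCost_eq hlam.ne', hy]
    field_simp
    ring
  rw [hform, hform]
  set T := optTime lam c q with hT
  -- The tangent line to r ↦ e^{-λr} at T lies below the graph.
  have hE : Real.exp (-lam * T) * (1 - lam * (t - T)) ≤ Real.exp (-lam * t) := by
    have h1 := Real.add_one_le_exp (-lam * (t - T))
    have h2 : Real.exp (-lam * t) = Real.exp (-lam * T) * Real.exp (-lam * (t - T)) := by
      rw [← Real.exp_add]; congr 1; ring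
    rw [h2]
    exact mul_le_mul_of_nonneg_left (by linarith) (Real.exp_pos _).le
  -- First-order condition: the slope at T is zero, or T = 0 and the slope is nonnegative.
  have hopt : 0 ≤ (1 - y * Real.exp (-lam * T)) * (t - T) := by
    rcases le_or_gt y 1 with h | h
    · have h1 : T = 0 := max_eq_left
        (div_nonpos_of_nonpos_of_nonneg (Real.log_nonpos hy0 h) hlam.le)
      rw [h1]
      simpa using mul_nonneg (sub_nonneg.2 h) ht
    · have h1 : T = Real.log y / lam :=
        max_eq_right (div_nonneg (Real.log_nonneg h.le) hlam.le)
      have h2 : -lam * T = -Real.log y := by rw [h1]; field_simp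
      rw [h2, Real.exp_neg, Real.exp_log (by linarith), mul_inv_cancel₀ (by linarith)]
      simp
  have h3 := mul_le_mul_of_nonneg_left hE hy0
  have h4 : y * Real.exp (-lam * T) + lam * T ≤ y * Real.exp (-lam * t) + lam * t := by
    nlinarith [mul_nonneg hlam.le hopt]
  have h5 := mul_le_mul_of_nonneg_left h4 (div_pos hc hlam).le
  linarith

lemma noObsCost_le (hlam : 0 < lam) (hc : 0 < c) (hq₁ : q ≤ 1) {t : ℝ} (ht : 0 ≤ t) :
    noObsCost lam c q ≤ waitCost lam c q t := by
  refine ciInf_le (f := fun t : ℝ≥0 => waitCost lam c q t) ?_ ⟨t, ht⟩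
  refine ⟨waitCost lam c q (optTime lam c q), ?_⟩
  rintro _ ⟨t, rfl⟩
  exact waitCost_optTime_le hlam hc hq₁ t.2

lemma noObsCost_eq (hlam : 0 < lam) (hc : 0 < c) (hq₁ : q ≤ 1) :
    noObsCost lam c q = waitCost lam c q (optTime lam c q) :=
  le_antisymm (noObsCost_le hlam hc hq₁ (optTime_nonneg lam c q))
    (le_ciInf (f := fun t : ℝ≥0 => waitCost lam c q t) fun t =>
      waitCost_optTime_le hlam hc hq₁ t.2)

end WaitCost

/-! ### The reduced cost in terms of stage delays -/

section ReducedCost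

lemma sum_toReal_sub {Ω : Type*} {X : ℝ≥0 → Ω → ℝ} (s : ObsSeq X) {ω : Ω} {m : ℕ} (h : s.time m ω ≠ ∞) :
    ∑ k ∈ Finset.range m, (s.time (k + 1) ω - s.time k ω).toReal = (s.time m ω).toReal := by
  induction m with
  | zero => simp [s.time_zero]
  | succ m ih =>
    have hle := s.monotone_time ω m.le_succ
    rw [Finset.sum_range_succ, ih (ne_top_of_le_ne_top h hle),
      ENNReal.toReal_sub_of_le hle h]
    simp

variable {Ω : Type*} [MeasurableSpace Ω] {P : Measure Ω} [IsProbabilityMeasure P] {p lam α : ℝ}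
  {M : DisorderModel P p lam} {s : ObsSeq (M.X α)}

/-- All terms are finite at a finite observation time, so the claim is the real identity Σ (D_k -
g_k/λ) = τ_m - Σ g_k/λ. -/
lemma reducedCost_eq_coe {c d : ℝ} (hlam : 0 < lam) (hc : 0 < c) (hd : 0 < d) {Q : ℝ≥0 → Ω → ℝ}
    {τ σ : Ω → ℝ≥0∞} {ω : Ω} {m : ℕ} (hm : s.count (τ ω) ω = m) (hσ : σ ω = s.time m ω)
    (hQ : ∀ t, Q t ω = posterior M s t ω) :
    reducedCost lam c d s Q σ ω =
      ((ENNReal.ofReal (noObsCost lam c (obsPosterior M s m ω)) +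
        ENNReal.ofReal c * totalDelay M s τ ω + ENNReal.ofReal d * numObs s τ ω : ℝ≥0∞) :
          EReal) := by
  have hfin : ∀ k ≤ m, s.time k ω ≠ ∞ := fun k hk => s.time_ne_top_of_count_eq hm hk
  have hσm : s.count (σ ω) ω = m := by rw [hσ]; exact s.count_time (hfin m le_rfl)
  have hQk : ∀ k ≤ m, Q (s.time k ω).toNNReal ω = obsPosterior M s k ω := fun k hk => by
    rw [hQ, posterior_time M s (hfin k hk)]
  set q : ℕ → ℝ := fun k => obsPosterior M s k ω with hq
  have hq₀ : ∀ k, 0 ≤ q k := fun k => obsPosterior_nonneg M s k ω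
  have hq₁ : ∀ k, q k ≤ 1 := fun k => obsPosterior_le_one M s k ω
  set D : ℕ → ℝ := fun k => (s.time (k + 1) ω - s.time k ω).toReal with hD
  have hD₀ : ∀ k, 0 ≤ D k := fun k => ENNReal.toReal_nonneg
  have hexp : ∀ k, Real.exp (-lam * D k) ≤ 1 := fun k => by
    rw [Real.exp_le_one_iff, neg_mul, neg_nonpos]; exact mul_nonneg hlam.le (hD₀ k)
  set g : ℕ → ℝ := fun k => (1 - q k) * (1 - Real.exp (-lam * D k)) with hg
  have hg₀ : ∀ k, 0 ≤ g k := fun k =>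
    mul_nonneg (sub_nonneg.2 (hq₁ k)) (sub_nonneg.2 (hexp k))
  have hint : ∀ k, ∫ u in (0 : ℝ)..D k, noObsPosterior lam (q k) u = D k - g k / lam :=
    fun k => integral_noObsPosterior hlam.ne' _ _
  have hint₀ : ∀ k, 0 ≤ D k - g k / lam := fun k => by
    rw [← hint]
    exact intervalIntegral.integral_nonneg (hD₀ k) fun u hu =>
      noObsPosterior_nonneg hlam.le (hq₀ k) hu.1
  have hdelay : totalDelay M s τ ω = ENNReal.ofReal (∑ k ∈ Finset.range m, (D k - g k / lam)) := by
    rw [totalDelay, s.tsum_ite_time_le hm, ENNReal.ofReal_sum_of_nonneg fun k _ => hint₀ k]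
    exact Finset.sum_congr rfl fun k _ => by rw [← hint]; rfl
  have hdisc : discountSum lam s Q σ ω = ENNReal.ofReal (∑ k ∈ Finset.range m, g k) := by
    rw [discountSum, s.tsum_ite_time_le hσm, ENNReal.ofReal_sum_of_nonneg fun k _ => hg₀ k]
    refine Finset.sum_congr rfl fun k hk => ?_
    have hk' := Finset.mem_range.1 hk
    have h1 : discount lam (s.time (k + 1) ω - s.time k ω) = Real.exp (-lam * D k) :=
      if_neg (ENNReal.sub_ne_top (hfin (k + 1) hk'))
    rw [hQk k hk'.le, h1]
  have hF₀ : 0 ≤ noObsCost lam c (q m) := by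
    rw [noObsCost_eq hlam hc (hq₁ m)]
    exact waitCost_nonneg hlam.le hc.le (hq₀ m) (hq₁ m) (optTime_nonneg _ _ _)
  have htime : σ ω = ENNReal.ofReal (s.time m ω).toReal := by
    rw [hσ, ENNReal.ofReal_toReal (hfin m le_rfl)]
  have hS₀ : 0 ≤ ∑ k ∈ Finset.range m, g k := Finset.sum_nonneg fun k _ => hg₀ k
  have hI₀ : 0 ≤ ∑ k ∈ Finset.range m, (D k - g k / lam) := Finset.sum_nonneg fun k _ => hint₀ k
  have hm₀ : (m : ℝ≥0∞) = ENNReal.ofReal m := by simp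
  have hcl : 0 ≤ c / lam := (div_pos hc hlam).le
  rw [reducedCost, s.numObs_eq hσm, s.numObs_eq hm, hdelay, hdisc, hσ, hQk m le_rfl, ← hσ, htime, hm₀,
    ← ENNReal.ofReal_mul hc.le, ← ENNReal.ofReal_mul hcl, ← ENNReal.ofReal_mul hd.le,
    ← ENNReal.ofReal_mul hc.le, ← ENNReal.ofReal_add hF₀ (mul_nonneg hc.le hI₀),
    ← ENNReal.ofReal_add (add_nonneg hF₀ (mul_nonneg hc.le hI₀)) (by positivity)]
  rw [EReal.coe_ennreal_ofReal, EReal.coe_ennreal_ofReal, EReal.coe_ennreal_ofReal,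
    EReal.coe_ennreal_ofReal, max_eq_left (by positivity), max_eq_left (mul_nonneg hcl hS₀),
    max_eq_left (by positivity), max_eq_left (by positivity), ← EReal.coe_add, ← EReal.coe_sub,
    ← EReal.coe_add]
  congr 1
  rw [Finset.sum_sub_distrib, ← Finset.sum_div, sum_toReal_sub s (hfin m le_rfl)]
  ring

end ReducedCost

/-! ### Times prescribed separately on each event {N = m} -/

section StageTime

variable {Ω : Type*} {X : ℝ≥0 → Ω → ℝ}

/-- The time `H m` on the event that `m` observations are made up to time `τ`. -/
def stageTime (s : ObsSeq X) (τ : Ω → ℝ≥0∞) (H : ℕ → Ω → ℝ≥0∞) (ω : Ω) : ℝ≥0∞ :=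
  if s.count (τ ω) ω = ⊤ then ∞ else H (s.count (τ ω) ω).toNat ω

lemma stageTime_of_count {s : ObsSeq X} {τ : Ω → ℝ≥0∞} {ω : Ω} {m : ℕ}
    (h : s.count (τ ω) ω = m) (H : ℕ → Ω → ℝ≥0∞) : stageTime s τ H ω = H m ω := by
  simp [stageTime, h]

lemma stageTime_le_coe (s : ObsSeq X) (τ : Ω → ℝ≥0∞) (H : ℕ → Ω → ℝ≥0∞) (t : ℝ≥0) :
    {ω | stageTime s τ H ω ≤ t} = ⋃ m : ℕ, {ω | s.count (τ ω) ω = m} ∩ {ω | H m ω ≤ t} := by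
  ext ω
  simp only [mem_ofPred_eq, mem_iUnion, mem_inter_iff]
  constructor
  · intro h
    have h1 : s.count (τ ω) ω ≠ ⊤ := by
      intro h1
      simp [stageTime, h1] at h
    obtain ⟨m, hm⟩ := ENat.ne_top_iff_exists.1 h1
    exact ⟨m, hm.symm, stageTime_of_count hm.symm H ▸ h⟩
  · rintro ⟨m, hm, h⟩
    rwa [stageTime_of_count hm]

lemma lastTime_hist_succ (σ : ℕ → Ω → ℝ≥0∞) (k : ℕ) (ω : Ω) :
    lastTime (k + 1) (hist X σ (k + 1 : ℕ) ω) = σ (k + 1) ω := by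
  simp [lastTime, hist, ENat.lt_add_one_iff]

end StageTime

/-! ### Dropping the observations after a stopping time -/

section Killed

variable {Ω : Type*} [MeasurableSpace Ω] {P : Measure Ω} {p lam α : ℝ}
  {M : DisorderModel P p lam} {s : ObsSeq (M.X α)} {τ : Ω → ℝ≥0∞}

lemma IsObsStopping.measurable (hτ : IsObsStopping M s τ) : Measurable τ := by
  refine measurable_of_Iic fun x => ?_
  induction x with
  | top => simp
  | coe r => exact (obsFiltration M s).le r _ (hτ r)

lemma IsObsStopping.measurable_numObs (hτ : IsObsStopping M s τ) : Measurable (numObs s τ) :=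
  Measurable.tsum fun k => Measurable.ite
    (measurableSet_le (s.measurable_time M (k + 1)) hτ.measurable) measurable_const measurable_const

lemma isObsStopping_stageTime {s' : ObsSeq (M.X α)}
    {H : ℕ → Ω → ℝ≥0∞} (h : ∀ (m : ℕ) (t : ℝ≥0),
      MeasurableSet[s'.recσ t] ({ω | s.count (τ ω) ω = m} ∩ {ω | H m ω ≤ t})) :
    IsObsStopping M s' (stageTime s τ H) := by
  intro t
  rw [obsFiltration_eq]
  have := stageTime_le_coe s τ H t
  exact this ▸ MeasurableSet.iUnion fun m => h m t

lemma isObsStopping_stageTime_time (hτ : IsObsStopping M s τ) :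
    IsObsStopping M s (stageTime s τ s.time) := by
  refine isObsStopping_stageTime fun m t => ?_
  have := s.measurableSet_recs_of_hist t (hτ.measurableSet_count_eq m)
  simpa only [s.le_count_iff] using this

/-- The observation times, no observation being made after time `τ`. -/
def killedTime {X : ℝ≥0 → Ω → ℝ} (s : ObsSeq X) (τ : Ω → ℝ≥0∞) (k : ℕ) (ω : Ω) : ℝ≥0∞ :=
  if s.time k ω ≤ τ ω then s.time k ω else ∞

lemma killedTime_eq_top_of_lt {k : ℕ} {ω : Ω} (h : τ ω < s.time k ω) : killedTime s τ k ω = ∞ :=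
  if_neg h.not_ge

lemma le_of_killedTime_ne_top {k : ℕ} {ω : Ω} (h : killedTime s τ k ω ≠ ∞) :
    s.time k ω ≤ τ ω := by
  by_contra h'
  exact h (if_neg h')

lemma killedTime_succ_eq_top {k : ℕ} {ω : Ω} (h : killedTime s τ k ω = ∞) :
    killedTime s τ (k + 1) ω = ∞ := by
  by_cases h1 : s.time k ω ≤ τ ω
  · have h2 : s.time k ω = ∞ := by simpa [killedTime, h1] using h
    simp [killedTime, s.top_succ k ω h2]
  · exact killedTime_eq_top_of_lt ((not_le.1 h1).trans_le (s.monotone_time ω k.le_succ))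

lemma hist_killedTime {k : ℕ} {ω : Ω} (h : s.time k ω ≤ τ ω) :
    hist (M.X α) (killedTime s τ) k ω = hist (M.X α) s.time k ω := by
  funext i
  unfold hist
  split_ifs with hi
  · have h1 : i + 1 ≤ k := by exact_mod_cast hi
    have h2 : killedTime s τ (i + 1) ω = s.time (i + 1) ω :=
      if_pos ((s.monotone_time ω h1).trans h)
    simp [observed, h2]
  · rfl

/-- The observation strategy `s`, stopped at time `τ`. -/
def IsObsStopping.killed (hτ : IsObsStopping M s τ) : ObsSeq (M.X α) where
  time := killedTime s τ
  time_zero ω := by simp [killedTime, s.time_zero]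
  lt_succ k ω h := by
    have h1 : s.time k ω ≤ τ ω := le_of_killedTime_ne_top h
    have h2 : killedTime s τ k ω = s.time k ω := if_pos h1
    rw [h2] at h ⊢
    refine (s.lt_succ k ω h).trans_le ?_
    unfold killedTime
    split_ifs
    · exact le_rfl
    · exact le_top
  top_succ k ω h := killedTime_succ_eq_top h
  first_deterministic := by
    obtain ⟨t, ht, hs⟩ := s.first_deterministic
    -- The event {τ_1 ≤ τ} depends only on the empty history, so it is everything or nothing, and
    -- the first killed time stays deterministic.
    obtain ⟨B, -, hB⟩ := hτ.measurableSet_time_le (j := 1) (k := (0 : ℕ)) (by simp)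
    have h0 : ∀ ω, hist (M.X α) s.time (0 : ℕ) ω = fun _ => (∞, 0) := fun ω => by
      funext i; simp [hist]
    have hmem : ∀ ω, s.time 1 ω ≤ τ ω ↔ (fun _ => (∞, 0) : Obs) ∈ B := fun ω => by
      rw [← h0 ω, ← mem_preimage, hB]; rfl
    by_cases hb : (fun _ => (∞, 0) : Obs) ∈ B
    · exact ⟨t, ht, fun ω => by rw [killedTime, if_pos ((hmem ω).2 hb), hs]⟩
    · exact ⟨∞, ENNReal.zero_lt_top, fun ω => by
        rw [killedTime, if_neg fun h => hb ((hmem ω).1 h)]⟩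
  measurable_history j hj := by
    obtain ⟨j, rfl⟩ : ∃ l, j = l + 1 := ⟨j - 1, by omega⟩
    have hm : Measurable[s.histσ (j + 1 : ℕ)] (killedTime s τ (j + 1 + 1)) := by
      have h1 : MeasurableSet[s.histσ (j + 1 : ℕ)] {ω | s.time (j + 1 + 1) ω ≤ τ ω} :=
        hτ.measurableSet_time_le le_rfl
      have h2 := s.measurable_time_succ (j + 1)
      exact Measurable.ite (m := s.histσ (j + 1 : ℕ)) h1 h2 measurable_const
    obtain ⟨g, hg, hgs⟩ := hm.exists_eq_measurable_comp
    -- The killed history reveals whether killing has occurred: if its last time is ∞, so is the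
    -- next one; otherwise it equals the original history and the original rule applies.
    have : killedTime s τ (j + 1 + 1) = (fun e => if lastTime (j + 1) e = ∞ then ∞ else g e) ∘
        hist (M.X α) (killedTime s τ) (j + 1 : ℕ) := by
      funext ω
      simp only [Function.comp_apply, lastTime_hist_succ]
      split_ifs with h
      · exact killedTime_succ_eq_top h
      · rw [hist_killedTime (le_of_killedTime_ne_top h), hgs]
        rfl
    rw [← comap_hist_eq, this]
    exact (Measurable.ite (measurable_lastTime (j + 1) (measurableSet_singleton ∞))
      measurable_const hg).comp (comap_measurable _)

lemma IsObsStopping.killed_time (hτ : IsObsStopping M s τ) (k : ℕ) (ω : Ω) :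
    hτ.killed.time k ω = if s.time k ω ≤ τ ω then s.time k ω else ∞ := rfl

lemma IsObsStopping.measurableSet_killed (hτ : IsObsStopping M s τ) {k : ℕ} {S : Set Ω}
    (hS : MeasurableSet[s.histσ k] S) :
    MeasurableSet[hτ.killed.histσ k] (S ∩ {ω | hτ.killed.time k ω ≠ ∞}) := by
  obtain ⟨B, hB, rfl⟩ := hS
  have : hist (M.X α) s.time k ⁻¹' B ∩ {ω | hτ.killed.time k ω ≠ ∞} =
      hist (M.X α) hτ.killed.time k ⁻¹' B ∩ {ω | hτ.killed.time k ω ≠ ∞} := by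
    ext ω
    simp only [mem_inter_iff, mem_preimage, mem_ofPred_eq, and_congr_left_iff]
    intro h
    rw [← hist_killedTime (le_of_killedTime_ne_top h)]
    rfl
  rw [this]
  exact MeasurableSet.inter ⟨B, hB, rfl⟩
    (hτ.killed.measurable_time_of_le (k := (k : ℕ∞)) (by exact_mod_cast k.le_succ)
      (measurableSet_singleton ∞).compl)

/-- On {N = m} the killed strategy still makes all m observations, and H m ≤ t implies τ_m ≤ t. They
are thus recorded by time t and determine both N = m and H m. -/
lemma IsObsStopping.isObsStopping_killed (hτ : IsObsStopping M s τ) {H : ℕ → Ω → ℝ≥0∞}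
    (hH : ∀ m : ℕ, Measurable[s.histσ m] (H m)) (hle : ∀ m ω, s.time m ω ≤ H m ω) :
    IsObsStopping M hτ.killed (stageTime s τ H) := by
  refine isObsStopping_stageTime fun m t => ?_
  have h1 : MeasurableSet[s.histσ m] ({ω | s.count (τ ω) ω = m} ∩ {ω | H m ω ≤ t}) :=
    (hτ.measurableSet_count_eq m).inter (hH m measurableSet_Iic)
  have h2 := hτ.killed.measurableSet_recs_of_hist t (hτ.measurableSet_killed h1)
  convert h2 using 1
  ext ω
  simp only [mem_inter_iff, mem_ofPred_eq, ObsSeq.le_count_iff]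
  constructor
  · rintro ⟨h3, h4⟩
    have h5 : hτ.killed.time m ω = s.time m ω := if_pos (s.count_eq_coe_iff.1 h3).1
    have h6 := (hle m ω).trans h4
    rw [h5]
    exact ⟨⟨⟨h3, h4⟩, ne_top_of_le_ne_top ENNReal.coe_ne_top h6⟩, h6⟩
  · exact fun h => h.1.1

lemma IsObsStopping.numObs_killed (hτ : IsObsStopping M s τ) {T : Ω → ℝ≥0∞} {ω : Ω} {m : ℕ}
    (hm : s.count (τ ω) ω = m) (hT : s.time m ω ≤ T ω) (hTf : T ω ≠ ∞) :
    numObs hτ.killed T ω = numObs s τ ω := by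
  unfold numObs
  refine tsum_congr fun k => ?_
  rw [hτ.killed_time]
  by_cases h : s.time (k + 1) ω ≤ τ ω
  · have h1 : (k : ℕ∞) < m := hm ▸ s.lt_count_iff.2 h
    have h2 : s.time (k + 1) ω ≤ T ω :=
      (s.monotone_time ω (by exact_mod_cast h1 : k + 1 ≤ m)).trans hT
    simp [h, h2]
  · simp [h, hTf]

end Killed

/-! ### The two inequalities -/

section Value

lemma reducedCost_eq_top {Ω : Type*} {X : ℝ≥0 → Ω → ℝ} {s : ObsSeq X} {lam c d : ℝ} (hc : 0 < c)
    {Q : ℝ≥0 → Ω → ℝ} {τ : Ω → ℝ≥0∞} {ω : Ω} {k : ℕ} (hk : s.time k ω = ∞) (hτ : τ ω = ∞) :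
    reducedCost lam c d s Q τ ω = ⊤ := by
  have h1 : discountSum lam s Q τ ω ≠ ∞ := by
    -- From the first infinite time on, the increments are ∞ - ∞ = 0 with discount 1, so only
    -- finitely many terms survive.
    rw [discountSum, tsum_eq_sum (s := Finset.range k)]
    · refine (ENNReal.sum_lt_top.2 fun j _ => ?_).ne
      split_ifs <;> simp
    · intro j hj
      have h2 : s.time j ω = ∞ :=
        top_le_iff.1 (hk ▸ s.monotone_time ω (by simpa using hj : k ≤ j))
      simp [h2, s.top_succ j ω h2, discount]
  have h3 : ENNReal.ofReal (c / lam) * discountSum lam s Q τ ω ≠ ∞ :=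
    ENNReal.mul_ne_top ENNReal.ofReal_ne_top h1
  rw [reducedCost, hτ, ENNReal.mul_top (by simpa using hc)]
  rw [EReal.coe_ennreal_top, EReal.coe_add_top, EReal.top_sub (by rwa [ne_eq, EReal.coe_ennreal_eq_top_iff]),
    EReal.top_add_of_ne_bot (EReal.coe_ennreal_ne_bot _)]

/-- At τ = ∞ even the placeholder times count, since ∞ ≤ ∞. For c > 0 this does not change the risk:
Θ is finite, so the delay is already infinite. -/
lemma numObs_eq_top {Ω : Type*} {X : ℝ≥0 → Ω → ℝ} {s : ObsSeq X} {τ : Ω → ℝ≥0∞} {ω : Ω}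
    (h : s.count (τ ω) ω = ⊤) : numObs s τ ω = ∞ := by
  have h1 : ∀ k, s.time (k + 1) ω ≤ τ ω := fun k => by
    rw [← s.lt_count_iff, h]; exact ENat.natCast_lt_top k
  simp [numObs, h1]

variable {Ω : Type*} [MeasurableSpace Ω] {P : Measure Ω} {p lam α : ℝ}
  {M : DisorderModel P p lam} {s : ObsSeq (M.X α)} {τ : Ω → ℝ≥0∞}

lemma IsObsStopping.risk_eq (hτ : IsObsStopping M s τ) {s' : ObsSeq (M.X α)} {T : Ω → ℝ≥0∞}
    (c d : ℝ) (h : ∀ᵐ ω ∂P, numObs s' T ω = numObs s τ ω) :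
    risk M c d s' T = P {ω | T ω < M.Θ ω} + ∫⁻ ω, ENNReal.ofReal c * (T ω - M.Θ ω) ∂P +
      ∫⁻ ω, ENNReal.ofReal d * numObs s τ ω ∂P := by
  rw [risk, add_assoc, ← lintegral_add_right _ (hτ.measurable_numObs.const_mul _)]
  congr 1
  refine lintegral_congr_ae ?_
  filter_upwards [h] with ω hω
  rw [hω]

lemma IsObsStopping.ae_exists_count {d : ℝ} (hd : 0 < d) (hτ : IsObsStopping M s τ)
    (h : ∫⁻ ω, ENNReal.ofReal d * numObs s τ ω ∂P ≠ ∞) :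
    ∀ᵐ ω ∂P, ∃ m : ℕ, s.count (τ ω) ω = m := by
  have h1 := ae_lt_top (hτ.measurable_numObs.const_mul (ENNReal.ofReal d)) h
  filter_upwards [h1] with ω hω
  by_contra hcon
  have h2 : s.count (τ ω) ω = ⊤ := by
    by_contra h3
    obtain ⟨m, hm⟩ := ENat.ne_top_iff_exists.1 h3
    exact hcon ⟨m, hm.symm⟩
  rw [numObs_eq_top h2, ENNReal.mul_top (by simpa using hd)] at hω
  exact lt_irrefl _ hω

lemma expectation_eq_of_ae_eq_coe {Z : Ω → EReal} {E : Ω → ℝ≥0∞}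
    (h : ∀ᵐ ω ∂P, Z ω = (E ω : EReal)) : expectation P Z = ((∫⁻ ω, E ω ∂P : ℝ≥0∞) : EReal) := by
  have h1 : ∫⁻ ω, (Z ω).toENNReal ∂P = ∫⁻ ω, E ω ∂P := by
    refine lintegral_congr_ae ?_
    filter_upwards [h] with ω hω
    rw [hω, EReal.toENNReal_coe]
  have h2 : ∫⁻ ω, (-Z ω).toENNReal ∂P = 0 := by
    rw [← lintegral_zero (μ := P)]
    refine lintegral_congr_ae ?_
    filter_upwards [h] with ω hω
    rw [hω]
    exact EReal.toENNReal_of_nonpos (by simpa using EReal.coe_ennreal_nonneg _)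
  rw [expectation, h1, h2]
  simp

variable [IsProbabilityMeasure P]

/-- The random cost whose expectation is the Bayes risk when the last decision is taken optimally. -/
def stageCost (M : DisorderModel P p lam) (c d : ℝ) (s : ObsSeq (M.X α)) (τ : Ω → ℝ≥0∞) (ω : Ω) :
    ℝ≥0∞ :=
  ∑' m : ℕ, {ω | s.count (τ ω) ω = m}.indicator
    (fun ω => ENNReal.ofReal (noObsCost lam c (obsPosterior M s m ω))) ω +
    ENNReal.ofReal c * totalDelay M s τ ω + ENNReal.ofReal d * numObs s τ ω

lemma reducedCost_eq_stageCost {c d : ℝ} (hlam : 0 < lam) (hc : 0 < c) (hd : 0 < d)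
    {Q : ℝ≥0 → Ω → ℝ} {σ : Ω → ℝ≥0∞} {ω : Ω} {m : ℕ} (hm : s.count (τ ω) ω = m)
    (hσ : σ ω = s.time m ω) (hQ : ∀ t, Q t ω = posterior M s t ω) :
    reducedCost lam c d s Q σ ω = (stageCost M c d s τ ω : EReal) := by
  rw [reducedCost_eq_coe hlam hc hd hm hσ hQ, stageCost,
    s.tsum_indicator_count hm fun m ω => ENNReal.ofReal (noObsCost lam c (obsPosterior M s m ω))]

/-- Replacing `τ` by the last observation time before `τ` does not increase the cost. -/
lemma expectation_lastObs_le_risk {c d : ℝ} (hlam : 0 < lam) (hc : 0 < c) (hd : 0 < d)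
    {Q : ℝ≥0 → Ω → ℝ} (hQ : IsPosterior M s Q) (hτ : IsObsStopping M s τ)
    (hN : ∀ᵐ ω ∂P, ∃ m : ℕ, s.count (τ ω) ω = m) :
    expectation P (reducedCost lam c d s Q (stageTime s τ s.time)) ≤ (risk M c d s τ : EReal) := by
  have h1 : ∀ᵐ ω ∂P, reducedCost lam c d s Q (stageTime s τ s.time) ω =
      (stageCost M c d s τ ω : EReal) := by
    filter_upwards [hN, hQ.indistinguishable (isPosterior_posterior M s)] with ω ⟨m, hm⟩ hω
    exact reducedCost_eq_stageCost hlam hc hd hm (stageTime_of_count hm _) hω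
  rw [expectation_eq_of_ae_eq_coe h1, EReal.coe_ennreal_le_coe_ennreal_iff,
    hτ.risk_eq c d (Filter.Eventually.of_forall fun _ => rfl),
    measure_lt_add_lintegral_delay hlam hc.le hτ hN hτ.measurable_indicator, 
    ← lintegral_add_right _ (hτ.measurable_numObs.const_mul _)]
  · refine lintegral_mono_ae ?_
    filter_upwards [hN] with ω ⟨m, hm⟩
    rw [stageCost, s.tsum_indicator_count hm fun m ω =>
      ENNReal.ofReal (noObsCost lam c (obsPosterior M s m ω)),
      s.tsum_indicator_count hm fun m ω => ENNReal.ofReal (waitCost lam c (obsPosterior M s m ω)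
        ({ω | s.count (τ ω) ω = m}.indicator τ ω - s.time m ω).toReal)]
    gcongr
    exact noObsCost_le hlam hc (obsPosterior_le_one M s m ω) ENNReal.toReal_nonneg
  · intro m ω hm
    rw [indicator_of_mem (show ω ∈ {ω | s.count (τ ω) ω = m} from hm)]
    have h2 := s.count_eq_coe_iff.1 hm
    exact ⟨rfl, h2.1, ne_top_of_lt h2.2⟩

/-- Stopping the observations at `τ` and then waiting for the optimal time. -/
lemma value_le_lintegral_stageCost {c d : ℝ} (hlam : 0 < lam) (hc : 0 < c)
    (hτ : IsObsStopping M s τ) (hN : ∀ᵐ ω ∂P, ∃ m : ℕ, s.count (τ ω) ω = m) :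
    value M α c d ≤ ∫⁻ ω, stageCost M c d s τ ω ∂P := by
  -- The minimiser of the waiting cost depends only on the posterior at τ_m, hence on the first m
  -- observations, as a killed stopping rule requires.
  set H : ℕ → Ω → ℝ≥0∞ := fun m ω =>
    s.time m ω + ENNReal.ofReal (optTime lam c (obsPosterior M s m ω)) with hHdef
  have hH : ∀ m : ℕ, Measurable[s.histσ m] (H m) := fun m =>
    (s.measurable_time_of_le (k := (m : ℕ∞)) (by exact_mod_cast m.le_succ)).add
      ((measurable_optTime lam c).comp (measurable_obsPosterior M s m)).ennreal_ofReal
  have hle : ∀ m ω, s.time m ω ≤ H m ω := fun m ω => le_self_add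
  have hHfin : ∀ (m : ℕ) ω, s.count (τ ω) ω = m → H m ω ≠ ∞ := fun m ω hm =>
    ENNReal.add_ne_top.2 ⟨s.time_ne_top_of_count_eq hm le_rfl, ENNReal.ofReal_ne_top⟩
  have hnum : ∀ᵐ ω ∂P, numObs hτ.killed (stageTime s τ H) ω = numObs s τ ω := by
    filter_upwards [hN] with ω ⟨m, hm⟩
    refine hτ.numObs_killed hm ?_ ?_ <;> rw [stageTime_of_count hm]
    · exact hle m ω
    · exact hHfin m ω hm
  refine (iInf_le_of_le hτ.killed (iInf₂_le (stageTime s τ H)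
    (hτ.isObsStopping_killed hH hle))).trans ?_
  rw [hτ.risk_eq c d hnum, measure_lt_add_lintegral_delay hlam hc.le hτ hN hH fun m ω hm =>
    ⟨stageTime_of_count hm _, hle m ω, hHfin m ω hm⟩,
    ← lintegral_add_right _ (hτ.measurable_numObs.const_mul _)]
  refine lintegral_mono_ae ?_
  filter_upwards [hN] with ω ⟨m, hm⟩
  rw [stageCost, s.tsum_indicator_count hm fun m ω =>
    ENNReal.ofReal (noObsCost lam c (obsPosterior M s m ω)),
    s.tsum_indicator_count hm fun m ω => ENNReal.ofReal (waitCost lam c (obsPosterior M s m ω)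
      (H m ω - s.time m ω).toReal)]
  have h2 : (H m ω - s.time m ω).toReal = optTime lam c (obsPosterior M s m ω) := by
    rw [hHdef]
    beta_reduce
    rw [ENNReal.add_sub_cancel_left (s.time_ne_top_of_count_eq hm le_rfl),
      ENNReal.toReal_ofReal (optTime_nonneg _ _ _)]
  rw [h2, noObsCost_eq hlam hc (obsPosterior_le_one M s m ω)]

lemma value_le_expectation {c d : ℝ} (hlam : 0 < lam) (hc : 0 < c) (hd : 0 < d)
    {Q : ℝ≥0 → Ω → ℝ} (hQ : IsPosterior M s Q) (hτ : IsObsStopping₀ M s τ) :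
    (value M α c d : EReal) ≤ expectation P (reducedCost lam c d s Q τ) := by
  have hcase : ∀ ω, (∃ k, τ ω = s.time k ω) →
      (∃ m : ℕ, s.count (τ ω) ω = m ∧ τ ω = s.time m ω) ∨
        (s.count (τ ω) ω = ⊤ ∧ τ ω = ∞ ∧ ∃ k, s.time k ω = ∞) := by
    rintro ω ⟨k, hk⟩
    by_cases h : s.time k ω = ∞
    · refine Or.inr ⟨?_, hk.trans h, k, h⟩
      rw [ENat.eq_top_iff_forall_ge]
      intro j
      rw [s.le_count_iff, hk, h]
      exact le_top
    · exact Or.inl ⟨k, hk ▸ s.count_time h, hk⟩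
  have hfin : ∀ᵐ ω ∂P, (∃ m : ℕ, s.count (τ ω) ω = m) →
      reducedCost lam c d s Q τ ω = (stageCost M c d s τ ω : EReal) := by
    filter_upwards [hτ.2, hQ.indistinguishable (isPosterior_posterior M s)] with ω h1 hω
    rintro ⟨m, hm⟩
    rcases hcase ω h1 with ⟨j, hj, h2⟩ | ⟨h2, -⟩
    · exact reducedCost_eq_stageCost hlam hc hd hj h2 hω
    · simp [h2] at hm
  have hE : ∀ᵐ ω ∂P, reducedCost lam c d s Q τ ω = (stageCost M c d s τ ω : EReal) := by
    filter_upwards [hτ.2, hfin] with ω h1 h2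
    rcases hcase ω h1 with ⟨j, hj, -⟩ | ⟨h3, h4, k, h5⟩
    · exact h2 ⟨j, hj⟩
    · rw [reducedCost_eq_top hc h5 h4, stageCost, numObs_eq_top h3,
        ENNReal.mul_top (by simpa using hd)]
      simp
  rw [expectation_eq_of_ae_eq_coe hE, EReal.coe_ennreal_le_coe_ennreal_iff]
  -- If the count is infinite with positive probability, the observation cost makes the right-hand
  -- side infinite.
  by_cases hN : ∀ᵐ ω ∂P, ∃ m : ℕ, s.count (τ ω) ω = m
  · exact value_le_lintegral_stageCost hlam hc hτ.1 hN
  · refine le_of_le_of_eq le_top (Eq.symm ?_)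
    by_contra hne
    exact hN (hτ.1.ae_exists_count hd
      (ne_top_of_le_ne_top hne (lintegral_mono fun ω => le_add_self)))

theorem value_eq_iInf_expectation {c d : ℝ} (hlam : 0 < lam) (hc : 0 < c) (hd : 0 < d)
    (M : DisorderModel P p lam) {Q : ObsSeq (M.X α) → ℝ≥0 → Ω → ℝ}
    (hQ : ∀ s, IsPosterior M s (Q s)) :
    (value M α c d : EReal) = ⨅ (s : ObsSeq (M.X α)) (τ : Ω → ℝ≥0∞) (_ : IsObsStopping₀ M s τ),
      expectation P (reducedCost lam c d s (Q s) τ) := by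
  apply le_antisymm
  · exact le_iInf fun s => le_iInf₂ fun τ hτ => value_le_expectation hlam hc hd (hQ s) hτ
  · set b : EReal := ⨅ (s : ObsSeq (M.X α)) (τ : Ω → ℝ≥0∞) (_ : IsObsStopping₀ M s τ),
      expectation P (reducedCost lam c d s (Q s) τ) with hb
    have h : ∀ (s : ObsSeq (M.X α)) (τ : Ω → ℝ≥0∞), IsObsStopping M s τ →
        b ≤ (risk M c d s τ : EReal) := by
      intro s τ hτ
      by_cases htop : risk M c d s τ = ∞
      · simp [htop]
      · have hN := hτ.ae_exists_count hd (ne_top_of_le_ne_top htop ((hτ.risk_eq c d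
          (Filter.Eventually.of_forall fun _ => rfl)).symm ▸ le_add_self))
        refine le_trans ?_ (expectation_lastObs_le_risk hlam hc hd (hQ s) hτ hN)
        refine iInf_le_of_le s (iInf₂_le _ ⟨isObsStopping_stageTime_time hτ, ?_⟩)
        filter_upwards [hN] with ω ⟨m, hm⟩
        exact ⟨m, stageTime_of_count hm _⟩
    -- The value is an infimum in [0, ∞], while b is one in the extended reals and not known to be
    -- nonnegative. The comparison is made after truncating b at 0, which can only increase it.
    have h2 : b.toENNReal ≤ value M α c d := by
      refine le_iInf fun s => le_iInf₂ fun τ hτ => ?_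
      have := EReal.toENNReal_le_toENNReal (h s τ hτ)
      rwa [EReal.toENNReal_coe] at this
    exact ((le_max_right 0 b).trans_eq EReal.coe_toENNReal_eq_max.symm).trans (EReal.coe_ennreal_le_coe_ennreal_iff.2 h2)

end Value

end CostlyDisorder

end

theorem mainTheorem6 {Ω : Type*} [MeasurableSpace Ω] (P : MeasureTheory.Measure Ω)
    [MeasureTheory.IsProbabilityMeasure P]
    (p lam α c d : ℝ) (hp₀ : 0 ≤ p) (hp₁ : p ≤ 1) (hlam : 0 < lam) (hc : 0 < c) (hd : 0 < d)
    (M : CostlyDisorder.DisorderModel P p lam) :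
    (∀ s : CostlyDisorder.ObsSeq (M.X α), ∃ Q : ℝ≥0 → Ω → ℝ, CostlyDisorder.IsPosterior M s Q) ∧
    ∀ Q : CostlyDisorder.ObsSeq (M.X α) → ℝ≥0 → Ω → ℝ,
      (∀ s, CostlyDisorder.IsPosterior M s (Q s)) →
      (CostlyDisorder.value M α c d : EReal) =
        ⨅ (s : CostlyDisorder.ObsSeq (M.X α)) (τ : Ω → ℝ≥0∞)
          (_ : CostlyDisorder.IsObsStopping₀ M s τ),
          CostlyDisorder.expectation P (CostlyDisorder.reducedCost lam c d s (Q s) τ) :=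
  ⟨fun s => ⟨_, CostlyDisorder.isPosterior_posterior M s⟩, fun _ hQ =>
    CostlyDisorder.value_eq_iInf_expectation hlam hc hd M hQ⟩
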